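/- Let $U=\{(\alpha,\beta): \tfrac12<\beta\le 1,\ 1-\beta<\alpha<\beta\}$ and for $(\alpha,\beta)\in U$ let $T_{\alpha,\beta}:[0,1]\to[0,1]$ be the skew tent map, $T_{\alpha,\beta}(x)=\frac{\beta}{\alpha}x$ for $0\le x\le\alpha$ and $T_{\alpha,\beta}(x)=\frac{\beta}{1-\alpha}(1-x)$ for $\alpha<x\le 1$. Its Frobenius–Perron operator is $$P_{\alpha,\beta}f(x)=\frac{\alpha}{\beta}f\Big(\frac{\alpha x}{\beta}\Big)+\frac{1-\alpha}{\beta}f\Big(1-\frac{1-\alpha}{\beta}x\Big)\ \text{ for } 0\le x\le\beta,\qquad P_{\alpha,\beta}f(x)=0\ \text{ for } x>\beta .$$ Let $\lambda$ be Lebesgue measure on $[0,1]$ and let $Vf$ be the total variation of $f:[0,1]\to\mathbb R$, i.e. the supremum of $\sum_i|f(x_i)-f(x_{i-1})|$ over all finite $x_0\le x_1\le\dots\le x_r$ in $[0,1]$. A density is an integrable $f$ on $[0,1]$ with $f\ge0$ almost everywhere and $\int_0^1 f\,d\lambda=1$; it is an invariant density of $T_{\alpha,\beta}$ if the measure $f\,d\lambda$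 is $T_{\alpha,\beta}$-invariant. **Proposition.** Suppose $(\alpha_n,\beta_n)\in U$ for $n=0,1,2,\dots$ and $(\alpha_n,\beta_n)\to(\alpha_0,\beta_0)$ as $n\to\infty$. Let $\mathcal P_n=\{[0,\alpha_n],[\alpha_n,1]\}$ and, for $m\ge1$, let $\mathcal P_n^{(m)}=\bigvee_{j=0}^{m-1}T_{\alpha_n,\beta_n}^{-j}(\mathcal P_n)$ be the partition of $[0,1]$ into the nondegenerate intervals of the form $I_0\cap T_{\alpha_n,\beta_n}^{-1}(I_1)\cap\dots\cap T_{\alpha_n,\beta_n}^{-(m-1)}(I_{m-1})$ with $I_0,\dots,I_{m-1}\in\mathcal P_n$. Suppose that for every $m\ge1$ there is $\delta_m>0$ such that $\lambda(I)\ge\delta_m$ for all $n\geq 0$ and all $I\in\mathcal P_n^{(m)}$. Then: (A) For every density $f$ of bounded variation there is a constant $M$ such that $V\big(P_{\alpha_n,\beta_n}^k f\big)\le M$ for all $n\ge0$ and all $k\ge1$. Moreover, for every $n\geq 0$ there is an invariant density of $T_{\alpha_n,\beta_n}$, and if $f_n$ is an invariant density of $T_{\alpha_n,\beta_n}$ for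 each $n\ge0$, then $\{f_n:n\ge0\}$ is precompact in $L^1([0,1],\lambda)$. (B) If, for such $f_n$, a subsequence $f_{n_k}$ converges in $L^1$ to some $g$, then $g$ is an invariant density of $T_{\alpha_0,\beta_0}$. -/

import Mathlib

open MeasureTheory Set Filter Topology
open scoped NNReal ENNReal

noncomputable section

namespace SkewTent

/-- The parameter region `U`: all `(α, β)` with `1/2 < β ≤ 1` and `1 - β < α < β`. -/
def paramRegion : Set (ℝ × ℝ) :=
  {p | 1 / 2 < p.2 ∧ p.2 ≤ 1 ∧ 1 - p.2 < p.1 ∧ p.1 < p.2}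

/-- The skew tent map `T_{α,β}`; for `(α, β) ∈ U` it maps `[0,1]` into itself, and only its values
on `[0,1]` matter below. -/
def tent (α β x : ℝ) : ℝ :=
  if x ≤ α then β / α * x else β / (1 - α) * (1 - x)

/-- The Frobenius-Perron operator `P_{α,β}`, in explicit form. Only values of `f` on `[0,1]` are
used when `(α, β) ∈ U`. -/
def frobeniusPerron (α β : ℝ) (f : ℝ → ℝ) (x : ℝ) : ℝ :=
  if 0 ≤ x ∧ x ≤ β then
    α / β * f (α * x / β) + (1 - α) / β * f (1 - (1 - α) * x / β)
  else 0

/-- The partition `{[0, α], [α, 1]}` of `[0,1]`. -/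
def basePartition (α : ℝ) : Set (Set ℝ) := {Icc 0 α, Icc α 1}

/-- The cylinder partition `⋁_{j < m} T⁻ʲ 𝒫` of `[0,1]` (for `m ≥ 1`) with `𝒫 = {[0, α], [α, 1]}`:
the nondegenerate intervals among the intersections `⋂_{j < m} T⁻ʲ(I_j)`, `I_j ∈ 𝒫`. Since the
elements of `𝒫` are closed, some of these intersections may be empty or reduce to one point;
those are not intervals of the partition. -/
def cylinderPartition (α β : ℝ) (m : ℕ) : Set (Set ℝ) :=
  {A | (interior A).Nonempty ∧
    ∃ I : Fin m → Set ℝ, (∀ j, I j ∈ basePartition α) ∧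
      A = ⋂ j : Fin m, (tent α β)^[(j : ℕ)] ⁻¹' I j}

/-- Lebesgue measure on `[0,1]`. -/
def lebUnit : Measure ℝ := volume.restrict (Icc 0 1)

/-- `f` is a (probability) density on `[0,1]`. -/
structure IsDensity (f : ℝ → ℝ) : Prop where
  integrable : Integrable f lebUnit
  nonneg : ∀ᵐ x ∂lebUnit, 0 ≤ f x
  integral_eq_one : ∫ x, f x ∂lebUnit = 1

/-- `f` is an invariant density of `T_{α,β}`: a density on `[0,1]` such that the absolutely
continuous measure `f dλ` is invariant under `T_{α,β}`. -/
structure IsInvariantDensity (α β : ℝ) (f : ℝ → ℝ) : Prop where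
  isDensity : IsDensity f
  invariant : MeasurePreserving (tent α β)
    (lebUnit.withDensity fun x => ENNReal.ofReal (f x))
    (lebUnit.withDensity fun x => ENNReal.ofReal (f x))

end SkewTent

end

noncomputable section

namespace SkewTent

/-! ### Total variation -/

/-! The variation is taken over all points, not up to null sets, so values at single points count.
Both inverse branches send `β` to the turning point `α`, which creates a spike at `β`. Writing the
Frobenius-Perron operator as `prunedFP` plus that spike (`frobeniusPerron_eq_pruned`) separates two
problems.

For the pruned operator a Lasota-Yorke inequality holds (`eVariationOn_prunedFP_iterate_le`). Its
`m`-th iterate is a sum over itineraries of `f` composed with a monotone inverse branch, cut off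
outside an interval. Each cut costs the supremum of `|f|` on the cylinder, which is at most its
variation there plus its mean; the mean is controlled by the lower bound on cylinder lengths. With
`κ` bounding both inverse slopes, the variation enters with the factor `3 κ ^ m`, at most `1/2` for
large `m`. Convergence of the parameters to a member of the sequence makes `κ < 1` uniform.

The spikes travel along the orbit of `β`, multiplied by an inverse slope at each step, except at
`α`, where the factor is `1 / β ≥ 1`. The danger is a periodic turning point. In
`prod_normWeight_le` the product over one period is still at most `κ`: either three of the factors
already suffice, or the second iterate renormalizes to a tent map for which the turning point has
half the period. Hence the total weight is bounded in terms of `κ` alone (`sum_prod_tentWeight_le`),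
which gives the uniform bound on variations.

In `L¹` the two operators agree. Sets of functions with bounded variation and supremum are totally
bounded (`totallyBounded_bvSet`), so averages of iterates have limits, and these are invariant. Any
invariant density is approximated by a function of bounded variation; iterating the pruned operator
on the latter does not increase the `L¹` distance and brings its variation below a uniform constant,
whence precompactness. Invariance passes to limits because it can be tested on bounded continuous
functions and the map depends continuously on its parameters. -/

lemma eVariationOn_add_le (f g : ℝ → ℝ) (s : Set ℝ) :
    eVariationOn (fun x => f x + g x) s ≤ eVariationOn f s + eVariationOn g s := by
  refine iSup_le ?_
  rintro ⟨n, u, hu, us⟩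
  calc _ ≤ ∑ i ∈ Finset.range n, (edist (f (u (i + 1))) (f (u i)) +
        edist (g (u (i + 1))) (g (u i))) := Finset.sum_le_sum fun i _ => edist_add_add_le _ _ _ _
    _ = _ := Finset.sum_add_distrib
    _ ≤ _ := add_le_add (eVariationOn.sum_le hu us) (eVariationOn.sum_le hu us)

lemma eVariationOn_const_mul (c : ℝ) (f : ℝ → ℝ) (s : Set ℝ) :
    eVariationOn (fun x => c * f x) s ≤ ENNReal.ofReal |c| * eVariationOn f s := by
  refine iSup_le ?_
  rintro ⟨n, u, hu, us⟩
  calc _ = ∑ i ∈ Finset.range n, ENNReal.ofReal |c| * edist (f (u (i + 1))) (f (u i)) := by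
        refine Finset.sum_congr rfl fun i _ => ?_
        rw [edist_dist, edist_dist, Real.dist_eq, Real.dist_eq, ← mul_sub, abs_mul,
          ENNReal.ofReal_mul (abs_nonneg c)]
    _ = _ := (Finset.mul_sum ..).symm
    _ ≤ _ := mul_le_mul_right (eVariationOn.sum_le hu us) _

lemma eVariationOn_finset_sum_le {ι : Type*} (t : Finset ι) (f : ι → ℝ → ℝ) (s : Set ℝ) :
    eVariationOn (fun x => ∑ i ∈ t, f i x) s ≤ ∑ i ∈ t, eVariationOn (f i) s := by
  classical
  induction t using Finset.induction_on with
  | empty =>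
    simp only [Finset.sum_empty, nonpos_iff_eq_zero]
    exact eVariationOn.constant_on (by rintro _ ⟨x, _, rfl⟩ _ ⟨y, _, rfl⟩; rfl)
  | insert a t ha ih =>
    simp only [Finset.sum_insert ha]
    exact (eVariationOn_add_le _ _ _).trans (add_le_add le_rfl ih)

/-- Along an increasing chain the cut-off function follows `f` and then stays at `0`, so there is
only one extra jump, of size at most `b`. -/
lemma eVariationOn_indicator_lower {f : ℝ → ℝ} {s B : Set ℝ} (hB : IsLowerSet B) {b : ℝ≥0∞}
    (hb : ∀ x ∈ s ∩ B, edist (f x) 0 ≤ b) :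
    eVariationOn (B.indicator f) s ≤ eVariationOn f (s ∩ B) + b := by
  refine iSup_le ?_
  rintro ⟨n, u, hu, us⟩
  dsimp only
  have key : ∀ n, u n ∈ B → ∑ i ∈ Finset.range n,
      edist (B.indicator f (u (i + 1))) (B.indicator f (u i)) ≤ eVariationOn f (s ∩ B) := by
    intro n hn
    have hmem : ∀ i ≤ n, u i ∈ B := fun i hi => hB (hu hi) hn
    calc _ = ∑ i ∈ Finset.range n, edist (f (u (i + 1))) (f (u i)) := by
          refine Finset.sum_congr rfl fun i hi => ?_
          rw [Finset.mem_range] at hi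
          rw [indicator_of_mem (hmem _ hi), indicator_of_mem (hmem _ hi.le)]
      _ ≤ _ := eVariationOn.sum_le_of_monotoneOn_Iic (hu.monotoneOn _)
          fun i hi => And.intro (us i) (hmem i hi)
  induction n with
  | zero => simp
  | succ n ih =>
    by_cases hn : u (n + 1) ∈ B
    · exact (key _ hn).trans le_self_add
    rw [Finset.sum_range_succ, indicator_of_notMem hn]
    by_cases hn' : u n ∈ B
    · refine add_le_add (key _ hn') ?_
      rw [indicator_of_mem hn', edist_comm]
      exact hb _ ⟨us n, hn'⟩
    · simpa [indicator_of_notMem hn'] using ih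

lemma eVariationOn_indicator_upper {f : ℝ → ℝ} {s A : Set ℝ} (hA : IsUpperSet A) {b : ℝ≥0∞}
    (hb : ∀ x ∈ s ∩ A, edist (f x) 0 ≤ b) :
    eVariationOn (A.indicator f) s ≤ eVariationOn f (s ∩ A) + b := by
  refine iSup_le ?_
  rintro ⟨n, u, hu, us⟩
  dsimp only
  have key : ∀ (v : ℕ → ℝ) n, Monotone v → (∀ i, v i ∈ s) → v 0 ∈ A → ∑ i ∈ Finset.range n,
      edist (A.indicator f (v (i + 1))) (A.indicator f (v i)) ≤ eVariationOn f (s ∩ A) := by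
    intro v n hv hvs h0
    have hmem : ∀ i, v i ∈ A := fun i => hA (hv (Nat.zero_le i)) h0
    simp only [indicator_of_mem (hmem _)]
    exact eVariationOn.sum_le hv fun i => ⟨hvs i, hmem i⟩
  induction n generalizing u with
  | zero => simp
  | succ n ih =>
    by_cases h0 : u 0 ∈ A
    · exact (key _ _ hu us h0).trans le_self_add
    have hu' : Monotone fun i => u (i + 1) := fun i j h => hu (by omega)
    rw [Finset.sum_range_succ', indicator_of_notMem h0]
    by_cases h1 : u 1 ∈ A
    · refine add_le_add (key (fun i => u (i + 1)) n hu' (fun i => us _) h1) ?_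
      rw [zero_add, indicator_of_mem h1]
      exact hb _ ⟨us _, h1⟩
    · simpa [indicator_of_notMem h1] using ih (fun i => u (i + 1)) hu' fun i => us _

/-- An order-connected set is the intersection of its upper and lower closures; each of the two cuts
costs one jump. -/
lemma eVariationOn_indicator_ordConnected {f : ℝ → ℝ} {s K : Set ℝ} (hK : K.OrdConnected)
    {b : ℝ≥0∞} (hb : ∀ x ∈ K, edist (f x) 0 ≤ b) :
    eVariationOn (K.indicator f) s ≤ eVariationOn f K + 2 * b := by
  have hKeq : (upperClosure K : Set ℝ) ∩ lowerClosure K = K := hK.upperClosure_inter_lowerClosure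
  have e : K.indicator f =
      (upperClosure K : Set ℝ).indicator ((lowerClosure K : Set ℝ).indicator f) := by
    rw [indicator_indicator, hKeq]
  have hsub : s ∩ upperClosure K ∩ lowerClosure K ⊆ K := by
    rw [inter_assoc, hKeq]; exact inter_subset_right
  rw [e]
  calc _ ≤ eVariationOn ((lowerClosure K : Set ℝ).indicator f) (s ∩ upperClosure K) + b := by
        refine eVariationOn_indicator_upper (upperClosure K).upper fun x hx => ?_
        by_cases h : x ∈ (lowerClosure K : Set ℝ)
        · rw [indicator_of_mem h]; exact hb x (hsub ⟨hx, h⟩)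
        · simp [indicator_of_notMem h]
    _ ≤ eVariationOn f (s ∩ upperClosure K ∩ lowerClosure K) + b + b := by
        gcongr
        exact eVariationOn_indicator_lower (lowerClosure K).lower fun x hx => hb x (hsub hx)
    _ ≤ eVariationOn f K + b + b := by gcongr; exact eVariationOn.mono _ hsub
    _ = _ := by rw [add_assoc, two_mul]

lemma eVariationOn_single_le (y : ℝ) (s : Set ℝ) :
    eVariationOn (({y} : Set ℝ).indicator fun _ => (1 : ℝ)) s ≤ 2 := by
  refine (eVariationOn_indicator_ordConnected (ordConnected_singleton) (b := 1) ?_).trans ?_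
  · simp
  · simp

/-! ### Returns of the turning point -/

/-- The skew tent map in the coordinate in which the turning point is `0` and its value is `1`;
`u` and `v` are the reciprocals of the two slopes. -/
def normTent (u v y : ℝ) : ℝ := if y ≤ 0 then 1 + y / u else 1 - y / v

/-- The weight with which the Frobenius-Perron operator transports a point mass at `y`: at the
turning point both branches contribute. -/
def normWeight (u v y : ℝ) : ℝ := if y < 0 then u else if 0 < y then v else u + v

section returns

variable {u v κ : ℝ}

lemma normTent_zero : normTent u v 0 = 1 := by simp [normTent]

lemma normTent_one : normTent u v 1 = 1 - 1 / v := by simp [normTent]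

lemma normWeight_neg {y : ℝ} (h : y < 0) : normWeight u v y = u := by simp [normWeight, h]

lemma normWeight_pos {y : ℝ} (h : 0 < y) : normWeight u v y = v := by
  simp [normWeight, h, h.not_gt]

lemma normWeight_zero : normWeight u v 0 = u + v := by simp [normWeight]

lemma normWeight_nonneg (hu : 0 < u) (hv : 0 < v) (y : ℝ) : 0 ≤ normWeight u v y := by
  unfold normWeight; split_ifs <;> positivity

lemma normWeight_le (huκ : u ≤ κ) (hvκ : v ≤ κ) {y : ℝ} (hy : y ≠ 0) : normWeight u v y ≤ κ := by
  rcases hy.lt_or_gt with h | h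
  · rwa [normWeight_neg h]
  · rwa [normWeight_pos h]

lemma normTent_mem (hu : 0 < u) (hv : 0 < v) (huv : 1 ≤ u + v) {y : ℝ}
    (hy : y ∈ Icc (1 - 1 / v) 1) : normTent u v y ∈ Icc (1 - 1 / v) 1 := by
  obtain ⟨h1, h2⟩ := hy
  unfold normTent
  split_ifs with h
  · constructor
    · have h3 : y * (1 / u) ≥ (1 - 1 / v) * (1 / u) := by gcongr
      -- Invariance of the interval uses `1 ≤ u + v` here: the image of the left endpoint must not
      -- fall below that endpoint.
      have h4 : (1 - 1 / v) * (1 / u) ≥ - (1 / v) := by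
        rw [ge_iff_le, ← sub_nonneg]
        have : (1 - 1 / v) * (1 / u) - -(1 / v) = (u + v - 1) / (u * v) := by
          field_simp
          ring
        rw [this]
        have : 0 ≤ u + v - 1 := by linarith
        positivity
      rw [div_eq_mul_one_div y u]
      linarith
    · have : y / u ≤ 0 := div_nonpos_of_nonpos_of_nonneg h hu.le
      linarith
  · push Not at h
    constructor
    · gcongr
    · have : 0 ≤ y / v := by positivity
      linarith

lemma normTent_iterate_mem (hu : 0 < u) (hv : 0 < v) (hv1 : v < 1) (huv : 1 ≤ u + v) (j : ℕ) :
    (normTent u v)^[j] 0 ∈ Icc (1 - 1 / v) 1 := by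
  induction j with
  | zero =>
    have : 1 ≤ 1 / v := by rw [le_div_iff₀ hv]; linarith
    exact ⟨by simpa using this, zero_le_one⟩
  | succ j ih =>
    rw [Function.iterate_succ_apply']
    exact normTent_mem hu hv huv ih

/-- Renormalization: near the turning point, the second iterate is again a tent map. -/
lemma normTent_renorm (hu : 0 < u) (hv : 0 < v) (hv1 : v < 1)
    (hr : 1 ≤ v * (u + v)) {z : ℝ} (hz : z ∈ Icc (1 - 1 / (u * v)) 1) :
    0 < normTent u v ((1 - 1 / v) * z) ∧
    normTent u v (normTent u v ((1 - 1 / v) * z)) = (1 - 1 / v) * normTent (v ^ 2) (u * v) z := by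
  obtain ⟨h1, h2⟩ := hz
  have hc : 1 - 1 / v < 0 := by
    rw [sub_neg, lt_div_iff₀ hv]; linarith
  have huv' : 1 - v < u * v := by nlinarith
  rcases lt_or_ge z 0 with hz | hz
  · have hy : 0 < (1 - 1 / v) * z := mul_pos_of_neg_of_neg hc hz
    have e1 : normTent u v ((1 - 1 / v) * z) = 1 - (1 - 1 / v) * z / v :=
      if_neg hy.not_ge
    have hpos : 0 < 1 - (1 - 1 / v) * z / v := by
      have h3 : (1 - 1 / v) * z ≤ (1 - 1 / v) * (1 - 1 / (u * v)) :=
        mul_le_mul_of_nonpos_left h1 hc.le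
      have h4 : (1 - 1 / v) * (1 - 1 / (u * v)) < v := by
        have : (1 - 1 / v) * (1 - 1 / (u * v)) = (1 - v) * (1 - u * v) / (u * v ^ 2) := by
          field_simp
          ring
        rw [this, div_lt_iff₀ (by positivity)]
        have h5 : 1 - u * v ≤ v ^ 2 := by nlinarith
        have h6 : (1 - v) * (1 - u * v) ≤ (1 - v) * v ^ 2 :=
          mul_le_mul_of_nonneg_left h5 (by linarith)
        have h7 : (1 - v) * v ^ 2 < (u * v) * v ^ 2 := by gcongr
        nlinarith
      have : (1 - 1 / v) * z / v < 1 := by rw [div_lt_one hv]; linarith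
      linarith
    rw [e1]
    refine ⟨hpos, ?_⟩
    simp only [normTent, hpos.not_ge, hz.le, if_true, if_false]
    field_simp
    ring
  · have hy : (1 - 1 / v) * z ≤ 0 := mul_nonpos_of_nonpos_of_nonneg hc.le hz
    have e1 : normTent u v ((1 - 1 / v) * z) = 1 + (1 - 1 / v) * z / u :=
      if_pos hy
    have hpos : 0 < 1 + (1 - 1 / v) * z / u := by
      have h3 : (1 - 1 / v) * 1 ≤ (1 - 1 / v) * z := mul_le_mul_of_nonpos_left h2 hc.le
      have h4 : - u < 1 - 1 / v := by
        have : 1 - 1 / v = - ((1 - v) / v) := by field_simp; ring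
        rw [this, neg_lt_neg_iff, div_lt_iff₀ hv]
        exact huv'
      have : -1 < (1 - 1 / v) * z / u := by rw [lt_div_iff₀ hu]; linarith
      linarith
    rw [e1]
    refine ⟨hpos, ?_⟩
    rcases hz.eq_or_lt with rfl | hz
    · simp [normTent]
    simp only [normTent, hpos.not_ge, hz.not_ge, if_false]
    field_simp
    ring

/-- The rescaling factor `1 - 1 / v` is negative and exchanges the two sides. The extra `v` is the
weight of the intermediate point, which is positive by `normTent_renorm`. -/
lemma normWeight_renorm (hv : 0 < v) (hv1 : v < 1) (z : ℝ) :
    v * normWeight u v ((1 - 1 / v) * z) = normWeight (v ^ 2) (u * v) z := by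
  have hc : 1 - 1 / v < 0 := by
    rw [sub_neg, lt_div_iff₀ hv]; linarith
  rcases lt_trichotomy z 0 with hz | rfl | hz
  · rw [normWeight_pos (mul_pos_of_neg_of_neg hc hz), normWeight_neg hz]; ring
  · simp only [mul_zero, normWeight_zero]; ring
  · rw [normWeight_neg (mul_neg_of_neg_of_pos hc hz), normWeight_pos hz]; ring

lemma prod_range_two_mul (f : ℕ → ℝ) (q : ℕ) :
    ∏ j ∈ Finset.range (2 * q), f j = ∏ j ∈ Finset.range q, (f (2 * j) * f (2 * j + 1)) := by
  induction q with
  | zero => simp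
  | succ q ih => rw [Finset.prod_range_succ, ← ih, mul_add, mul_one, Finset.prod_range_succ,
      Finset.prod_range_succ, mul_assoc]

/-- Along a periodic orbit of the turning point the weights multiply to less than one. -/
lemma prod_normWeight_le (p : ℕ) : ∀ {u v κ : ℝ}, 0 < u → u ≤ κ → 0 < v → v ≤ κ → κ < 1 →
    1 ≤ u + v → 1 ≤ p → (normTent u v)^[p] 0 = 0 →
    (∀ j, 0 < j → j < p → (normTent u v)^[j] 0 ≠ 0) →
    ∏ j ∈ Finset.range p, normWeight u v ((normTent u v)^[j + 1] 0) ≤ κ := by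
  induction p using Nat.strong_induction_on with
  | _ p ih =>
  intro u v κ hu huκ hv hvκ hκ huv hp hp0 hmin
  have hv1 : v < 1 := by linarith
  have hu1 : u < 1 := by linarith
  have hc : 1 - 1 / v < 0 := by
    rw [sub_neg, lt_div_iff₀ hv]; linarith
  have hF1 : (normTent u v)^[1] 0 = 1 := by simp [normTent_zero]
  have hF2 : (normTent u v)^[2] 0 = 1 - 1 / v := by
    simp [Function.iterate_succ_apply', normTent_zero, normTent_one]
  -- This is exactly the condition under which the renormalized parameters `v ^ 2`, `u * v` again
  -- have sum at least one.
  by_cases hr : 1 ≤ v * (u + v)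
  · have huv1 : u * v < 1 := by nlinarith
    have hr' : 1 ≤ v ^ 2 + u * v := by nlinarith
    have hG : ∀ j, (normTent (v ^ 2) (u * v))^[j] 0 ∈ Icc (1 - 1 / (u * v)) 1 :=
      normTent_iterate_mem (by positivity) (by positivity) huv1 hr'
    have heven : ∀ j, (normTent u v)^[2 * j] 0 =
        (1 - 1 / v) * (normTent (v ^ 2) (u * v))^[j] 0 := by
      intro j
      induction j with
      | zero => simp
      | succ j ih =>
        rw [mul_add, mul_one, Function.iterate_succ_apply', Function.iterate_succ_apply', ih,
          (normTent_renorm hu hv hv1 hr (hG j)).2, Function.iterate_succ_apply' _ j]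
    have hodd : ∀ j, 0 < (normTent u v)^[2 * j + 1] 0 := by
      intro j
      rw [Function.iterate_succ_apply', heven]
      exact (normTent_renorm hu hv hv1 hr (hG j)).1
    -- Odd iterates of the turning point are positive, so the period is even and the renormalized
    -- map has period `q < p`.
    obtain ⟨q, rfl | rfl⟩ : ∃ q, p = 2 * q ∨ p = 2 * q + 1 := ⟨p / 2, by omega⟩
    swap
    · exact absurd hp0 (hodd q).ne'
    rw [prod_range_two_mul]
    have e : ∀ j ∈ Finset.range q, normWeight u v ((normTent u v)^[2 * j + 1] 0) *
        normWeight u v ((normTent u v)^[2 * j + 1 + 1] 0) =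
        normWeight (v ^ 2) (u * v) ((normTent (v ^ 2) (u * v))^[j + 1] 0) := by
      intro j _
      rw [normWeight_pos (hodd j), show 2 * j + 1 + 1 = 2 * (j + 1) by ring, heven,
        normWeight_renorm hv hv1]
    rw [Finset.prod_congr rfl e]
    refine ih q (by omega) (by positivity) (by nlinarith) (by positivity) (by nlinarith) hκ hr'
      (by omega) ?_ fun j hj hjq h0 => ?_
    · rw [heven] at hp0
      exact (mul_eq_zero.1 hp0).resolve_left hc.ne
    · exact hmin (2 * j) (by omega) (by omega) (by rw [heven, h0, mul_zero])
  · push Not at hr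
    have h3 : 3 ≤ p := by
      by_contra h
      obtain rfl | rfl : p = 1 ∨ p = 2 := by omega
      · rw [hF1] at hp0; norm_num at hp0
      · rw [hF2] at hp0; exact hc.ne hp0
    obtain ⟨r, rfl⟩ : ∃ r, p = r + 3 := ⟨p - 3, by omega⟩
    -- Without renormalization, the points `1` and `1 - 1 / v` contribute `v` and `u`, and the
    -- return to `0` contributes `u + v`. Their product is below `u ≤ κ`; the remaining weights are
    -- at most one.
    rw [Finset.prod_range_succ, hp0, normWeight_zero, Finset.prod_range_succ',
      Finset.prod_range_succ', hF1, hF2, normWeight_pos one_pos, normWeight_neg hc]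
    have hle : ∏ j ∈ Finset.range r, normWeight u v ((normTent u v)^[j + 1 + 1 + 1] 0) ≤ 1 := by
      refine Finset.prod_le_one (fun _ _ => normWeight_nonneg hu hv _) fun j hj => ?_
      rw [Finset.mem_range] at hj
      exact (normWeight_le huκ hvκ (hmin _ (by omega) (by omega))).trans hκ.le
    have h0 : 0 ≤ ∏ j ∈ Finset.range r, normWeight u v ((normTent u v)^[j + 1 + 1 + 1] 0) :=
      Finset.prod_nonneg fun _ _ => normWeight_nonneg hu hv _
    have e1 : ∀ X : ℝ, X * u * v * (u + v) = X * (u * (v * (u + v))) := fun X => by ring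
    rw [e1]
    have h5 : u * (v * (u + v)) ≤ κ := by nlinarith [mul_pos hu hv]
    have h6 : 0 ≤ u * (v * (u + v)) := by positivity
    nlinarith

end returns

/-! ### Elementary properties of the skew tent map -/

/-- The weight with which the Frobenius-Perron operator transports a point mass at `y`. -/
def tentWeight (α β y : ℝ) : ℝ :=
  if y < α then α / β else if α < y then (1 - α) / β else 1 / β

section tent

variable {α β κ : ℝ}

lemma paramRegion_bounds (h : (α, β) ∈ paramRegion) :
    0 < α ∧ α < 1 ∧ 0 < β ∧ β ≤ 1 ∧ α < β ∧ 1 - α < β ∧ 1 / 2 < β := by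
  obtain ⟨h1, h2, h3, h4⟩ := h
  simp only at h1 h2 h3 h4
  refine ⟨?_, ?_, ?_, ?_, ?_, ?_, ?_⟩ <;> linarith

lemma tent_of_le {x : ℝ} (hx : x ≤ α) : tent α β x = β / α * x := if_pos hx

lemma tent_of_ge (h : (α, β) ∈ paramRegion) {x : ℝ} (hx : α ≤ x) :
    tent α β x = β / (1 - α) * (1 - x) := by
  obtain ⟨h0, h1, -⟩ := paramRegion_bounds h
  rcases hx.eq_or_lt with rfl | hx
  · rw [tent_of_le le_rfl]
    have : 1 - α ≠ 0 := by linarith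
    field_simp
  · exact if_neg hx.not_ge

lemma tent_turning (h : (α, β) ∈ paramRegion) : tent α β α = β := by
  rw [tent_of_le le_rfl, div_mul_cancel₀ _ (paramRegion_bounds h).1.ne']

lemma tent_mapsTo (h : (α, β) ∈ paramRegion) {x : ℝ} (hx : x ∈ Icc (0 : ℝ) 1) :
    tent α β x ∈ Icc 0 β := by
  obtain ⟨h0, h1, h2, -⟩ := paramRegion_bounds h
  have h1' : 0 < 1 - α := by linarith
  rcases le_total x α with hxα | hxα
  · rw [tent_of_le hxα]
    have := hx.1
    refine ⟨by positivity, ?_⟩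
    rw [div_mul_eq_mul_div, div_le_iff₀ h0]
    gcongr
  · rw [tent_of_ge h hxα]
    have : 0 ≤ 1 - x := by linarith [hx.2]
    refine ⟨by positivity, ?_⟩
    rw [div_mul_eq_mul_div, div_le_iff₀ h1']
    gcongr

lemma tent_mem_unit (h : (α, β) ∈ paramRegion) {x : ℝ} (hx : x ∈ Icc (0 : ℝ) 1) :
    tent α β x ∈ Icc (0 : ℝ) 1 :=
  Icc_subset_Icc_right (paramRegion_bounds h).2.2.2.1 (tent_mapsTo h hx)

lemma tent_iterate_mem_unit (h : (α, β) ∈ paramRegion) {x : ℝ} (hx : x ∈ Icc (0 : ℝ) 1) (j : ℕ) :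
    (tent α β)^[j] x ∈ Icc (0 : ℝ) 1 := by
  induction j with
  | zero => exact hx
  | succ j ih => rw [Function.iterate_succ_apply']; exact tent_mem_unit h ih

lemma continuous_tent (h : (α, β) ∈ paramRegion) : Continuous (tent α β) := by
  unfold tent
  refine Continuous.if_le (by fun_prop) (by fun_prop) continuous_id continuous_const ?_
  rintro x rfl
  exact (tent_of_le (β := β) (le_refl x)).symm.trans (tent_of_ge h le_rfl)

/-- The affine coordinate sending `0` to `α` and `1` to `β` conjugates the two maps, with `u = α /
β` and `v = (1 - α) / β`. -/
lemma tent_eq_normTent (h : (α, β) ∈ paramRegion) (y : ℝ) :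
    tent α β (α + (β - α) * y) = α + (β - α) * normTent (α / β) ((1 - α) / β) y := by
  obtain ⟨h0, h1, h2, -, h4, -⟩ := paramRegion_bounds h
  have h1' : 1 - α ≠ 0 := by linarith
  rcases le_or_gt y 0 with hy | hy
  · have : (β - α) * y ≤ 0 := mul_nonpos_of_nonneg_of_nonpos (by linarith) hy
    rw [tent_of_le (by linarith), normTent, if_pos hy]
    field_simp
    ring
  · have : 0 ≤ (β - α) * y := mul_nonneg (by linarith) hy.le
    rw [tent_of_ge h (by linarith), normTent, if_neg hy.not_ge]
    field_simp
    ring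

lemma tent_iterate_turning (h : (α, β) ∈ paramRegion) (j : ℕ) :
    (tent α β)^[j] α = α + (β - α) * (normTent (α / β) ((1 - α) / β))^[j] 0 := by
  induction j with
  | zero => simp
  | succ j ih => rw [Function.iterate_succ_apply', ih, tent_eq_normTent h,
      Function.iterate_succ_apply']

lemma tentWeight_eq_normWeight (h : (α, β) ∈ paramRegion) (y : ℝ) :
    tentWeight α β (α + (β - α) * y) = normWeight (α / β) ((1 - α) / β) y := by
  obtain ⟨h0, h1, h2, -, h4, -⟩ := paramRegion_bounds h
  have h4' : 0 < β - α := by linarith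
  rcases lt_trichotomy y 0 with hy | rfl | hy
  · rw [normWeight_neg hy, tentWeight, if_pos (by nlinarith)]
  · rw [normWeight_zero]
    simp only [tentWeight, mul_zero, add_zero, lt_irrefl, if_false]
    ring
  · rw [normWeight_pos hy, tentWeight, if_neg (by nlinarith), if_pos (by nlinarith)]

lemma tentWeight_nonneg (h : (α, β) ∈ paramRegion) (y : ℝ) : 0 ≤ tentWeight α β y := by
  obtain ⟨h0, h1, h2, -⟩ := paramRegion_bounds h
  have h1' : 0 < 1 - α := by linarith
  unfold tentWeight; split_ifs <;> positivity

/-- The first period contributes at most `1 / (1 - κ)`, and the rest is at most `κ` times a shorter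
sum; the bound is the fixed point of this recursion and does not depend on `p`. -/
lemma sum_range_le_of_periodic_decay {m : ℕ → ℝ} (hκ0 : 0 ≤ κ) (hκ : κ < 1) {p : ℕ} (hp : 1 ≤ p)
    (h1 : ∀ i < p, m i ≤ κ ^ i) (h2 : ∀ i, m (p + i) ≤ κ * m i) (k : ℕ) :
    ∑ i ∈ Finset.range k, m i ≤ 1 / (1 - κ) ^ 2 := by
  have hκ' : 0 < 1 - κ := by linarith
  have hS : ∀ k ≤ p, ∑ i ∈ Finset.range k, m i ≤ 1 / (1 - κ) := by
    intro k hk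
    calc _ ≤ ∑ i ∈ Finset.range k, κ ^ i :=
          Finset.sum_le_sum fun i hi => h1 i (by rw [Finset.mem_range] at hi; omega)
      _ ≤ ∑' i, κ ^ i := (summable_geometric_of_lt_one hκ0 hκ).sum_le_tsum _
          fun i _ => pow_nonneg hκ0 i
      _ = _ := by rw [tsum_geometric_of_lt_one hκ0 hκ, one_div]
  have e : 1 / (1 - κ) + κ * (1 / (1 - κ) ^ 2) = 1 / (1 - κ) ^ 2 := by
    field_simp
    ring
  induction k using Nat.strong_induction_on with
  | _ k ih =>
  rcases le_total k p with hk | hk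
  · refine (hS k hk).trans ?_
    rw [← e]
    have : 0 ≤ κ * (1 / (1 - κ) ^ 2) := by positivity
    linarith
  · obtain ⟨r, rfl⟩ := Nat.exists_eq_add_of_le hk
    rw [Finset.sum_range_add, ← e]
    refine add_le_add (hS p le_rfl) ?_
    calc _ ≤ ∑ i ∈ Finset.range r, κ * m i := Finset.sum_le_sum fun i _ => h2 i
      _ = κ * ∑ i ∈ Finset.range r, m i := (Finset.mul_sum ..).symm
      _ ≤ _ := mul_le_mul_of_nonneg_left (ih r (by omega)) hκ0

/-- The total weight transported along the orbit of the turning value is bounded in terms of the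
expansion rate only. -/
lemma sum_prod_tentWeight_le (h : (α, β) ∈ paramRegion) (hκ1 : α / β ≤ κ) (hκ2 : (1 - α) / β ≤ κ)
    (hκ : κ < 1) (k : ℕ) :
    ∑ i ∈ Finset.range k, ∏ j ∈ Finset.range i, tentWeight α β ((tent α β)^[j] β) ≤
      1 / (1 - κ) ^ 2 := by
  obtain ⟨h0, h1, h2, h3, h4, -⟩ := paramRegion_bounds h
  set u := α / β with hu_def
  set v := (1 - α) / β with hv_def
  have hu : 0 < u := by positivity
  have hv : 0 < v := div_pos (by linarith) h2
  have huv : 1 ≤ u + v := by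
    rw [hu_def, hv_def, ← add_div, le_div_iff₀ h2]; linarith
  have hw : ∀ j, tentWeight α β ((tent α β)^[j] β) = normWeight u v ((normTent u v)^[j + 1] 0) := by
    intro j
    rw [← tentWeight_eq_normWeight h, ← tent_iterate_turning h, Function.iterate_succ_apply,
      tent_turning h]
  simp only [hw]
  have hle : ∀ i, (∀ j, 0 < j → j ≤ i → (normTent u v)^[j] 0 ≠ 0) →
      ∏ j ∈ Finset.range i, normWeight u v ((normTent u v)^[j + 1] 0) ≤ κ ^ i := by
    intro i hi
    calc _ ≤ ∏ j ∈ Finset.range i, κ := by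
          refine Finset.prod_le_prod (fun _ _ => normWeight_nonneg hu hv _) fun j hj => ?_
          rw [Finset.mem_range] at hj
          exact normWeight_le hκ1 hκ2 (hi _ (by omega) (by omega))
      _ = _ := by simp
  have hκ0 : 0 ≤ κ := hu.le.trans hκ1
  by_cases hper : ∃ p, 1 ≤ p ∧ (normTent u v)^[p] 0 = 0
  · classical
    obtain ⟨hp1, hp0⟩ := Nat.find_spec hper
    have hmin := fun j => Nat.find_min hper (m := j)
    set p := Nat.find hper
    have hmin' : ∀ j, 0 < j → j < p → (normTent u v)^[j] 0 ≠ 0 :=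
      fun j hj hjp h0 => hmin j hjp ⟨hj, h0⟩
    refine sum_range_le_of_periodic_decay hκ0 hκ hp1 (fun i hi => hle i fun j hj hji =>
      hmin' j hj (by omega)) (fun i => ?_) k
    rw [Finset.prod_range_add]
    have e : ∀ j, (normTent u v)^[p + j + 1] 0 = (normTent u v)^[j + 1] 0 := by
      intro j
      rw [show p + j + 1 = j + 1 + p by omega, Function.iterate_add_apply, hp0]
    simp only [e]
    exact mul_le_mul_of_nonneg_right
      (prod_normWeight_le p hu hκ1 hv hκ2 hκ huv hp1 hp0 hmin')
      (Finset.prod_nonneg fun _ _ => normWeight_nonneg hu hv _)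
  · push Not at hper
    have hκ' : 0 < 1 - κ := by linarith
    calc _ ≤ ∑ i ∈ Finset.range k, κ ^ i :=
          Finset.sum_le_sum fun i _ => hle i fun j hj _ => hper j hj
      _ ≤ ∑' i, κ ^ i := (summable_geometric_of_lt_one hκ0 hκ).sum_le_tsum _
          fun i _ => pow_nonneg hκ0 i
      _ = 1 / (1 - κ) := by rw [tsum_geometric_of_lt_one hκ0 hκ, one_div]
      _ ≤ _ := one_div_le_one_div_of_le (by positivity) (by nlinarith)

end tent

/-! ### The Frobenius-Perron operator and its pruned version -/

/-- The Frobenius-Perron operator without the contribution of the turning point. -/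
def prunedFP (α β : ℝ) (f : ℝ → ℝ) (x : ℝ) : ℝ :=
  if 0 ≤ x ∧ x < β then
    α / β * f (α * x / β) + (1 - α) / β * f (1 - (1 - α) * x / β)
  else 0

section pointwise

variable {α β : ℝ}

lemma frobeniusPerron_add (f g : ℝ → ℝ) :
    frobeniusPerron α β (fun x => f x + g x) =
      fun x => frobeniusPerron α β f x + frobeniusPerron α β g x := by
  ext x
  unfold frobeniusPerron
  split_ifs <;> ring

lemma frobeniusPerron_const_mul (c : ℝ) (f : ℝ → ℝ) :
    frobeniusPerron α β (fun x => c * f x) = fun x => c * frobeniusPerron α β f x := by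
  ext x
  unfold frobeniusPerron
  split_ifs <;> ring

lemma frobeniusPerron_zero : frobeniusPerron α β (fun _ => 0) = fun _ => 0 := by
  ext x
  simp [frobeniusPerron]

lemma frobeniusPerron_sum {ι : Type*} (t : Finset ι) (c : ι → ℝ) (f : ι → ℝ → ℝ) :
    frobeniusPerron α β (fun x => ∑ i ∈ t, c i * f i x) =
      fun x => ∑ i ∈ t, c i * frobeniusPerron α β (f i) x := by
  classical
  induction t using Finset.induction_on with
  | empty => simp only [Finset.sum_empty]; exact frobeniusPerron_zero
  | insert a t ha ih =>
    simp only [Finset.sum_insert ha]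
    rw [frobeniusPerron_add, frobeniusPerron_const_mul, ih]

/-- A point is hit by an inverse branch only from its image. Both branches hit `y` exactly when `y =
α`, and then the coefficients add up to `1 / β`. -/
lemma frobeniusPerron_single (h : (α, β) ∈ paramRegion) {y : ℝ} (hy : y ∈ Icc (0 : ℝ) 1) :
    frobeniusPerron α β (({y} : Set ℝ).indicator fun _ => 1) =
      fun x => tentWeight α β y * ({tent α β y} : Set ℝ).indicator (fun _ => 1) x := by
  obtain ⟨h0, h1, h2, -⟩ := paramRegion_bounds h
  have h1' : 0 < 1 - α := by linarith
  ext x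
  unfold frobeniusPerron
  by_cases hx : 0 ≤ x ∧ x ≤ β
  swap
  · rw [if_neg hx, indicator_of_notMem, mul_zero]
    rintro rfl
    exact hx (tent_mapsTo h hy)
  rw [if_pos hx]
  have eL : α * x / β = y ↔ y ≤ α ∧ x = tent α β y := by
    constructor
    · rintro rfl
      have : α * x / β ≤ α := by
        rw [div_le_iff₀ h2]; exact mul_le_mul_of_nonneg_left hx.2 h0.le
      refine ⟨this, ?_⟩
      rw [tent_of_le this]
      field_simp
    · rintro ⟨hyα, rfl⟩
      rw [tent_of_le hyα]
      field_simp
  have eR : 1 - (1 - α) * x / β = y ↔ α ≤ y ∧ x = tent α β y := by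
    constructor
    · rintro rfl
      have h4 : (1 - α) * x / β ≤ 1 - α := by
        rw [div_le_iff₀ h2]; exact mul_le_mul_of_nonneg_left hx.2 h1'.le
      have : α ≤ 1 - (1 - α) * x / β := by linarith
      refine ⟨this, ?_⟩
      rw [tent_of_ge h this]
      field_simp
      ring
    · rintro ⟨hyα, rfl⟩
      rw [tent_of_ge h hyα]
      field_simp
      ring
  simp only [indicator_apply, mem_singleton_iff, eL, eR]
  by_cases hxT : x = tent α β y
  · simp only [hxT, and_true, if_true, tentWeight]
    rcases lt_trichotomy y α with hyα | rfl | hyα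
    · simp [hyα, hyα.le, hyα.not_ge]
    · simp
      ring
    · simp [hyα, hyα.le, hyα.not_ge, hyα.not_gt]
  · simp [hxT]

lemma frobeniusPerron_eq_pruned (h : (α, β) ∈ paramRegion) (f : ℝ → ℝ) :
    frobeniusPerron α β f =
      fun x => prunedFP α β f x + f α / β * ({β} : Set ℝ).indicator (fun _ => 1) x := by
  obtain ⟨h0, h1, h2, -⟩ := paramRegion_bounds h
  ext x
  unfold frobeniusPerron prunedFP
  rcases lt_trichotomy x β with hx | rfl | hx
  · simp [hx, hx.le, hx.ne]
  · simp only [h2.le, le_refl, and_self, if_true, lt_irrefl, and_false, if_false,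
      mem_singleton_iff, indicator_of_mem]
    rw [mul_div_cancel_right₀ _ h2.ne', mul_div_cancel_right₀ _ h2.ne']
    ring_nf
  · simp [hx.not_ge, hx.not_gt, hx.ne']

/-- A Duhamel formula: the spike of age `i` was created at `β` from the value at `α` of the pruned
iterate of order `k - 1 - i`, and has since moved `i` steps along the orbit of `β`. -/
lemma frobeniusPerron_iterate_eq (h : (α, β) ∈ paramRegion) (f : ℝ → ℝ) (k : ℕ) :
    (frobeniusPerron α β)^[k] f = fun x => (prunedFP α β)^[k] f x +
      ∑ i ∈ Finset.range k, ((prunedFP α β)^[k - 1 - i] f α / β *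
        ∏ j ∈ Finset.range i, tentWeight α β ((tent α β)^[j] β)) *
          ({(tent α β)^[i] β} : Set ℝ).indicator (fun _ => 1) x := by
  obtain ⟨h0, h1, h2, h3, -⟩ := paramRegion_bounds h
  induction k with
  | zero => simp
  | succ k ih =>
    rw [Function.iterate_succ_apply', ih, frobeniusPerron_add, frobeniusPerron_sum]
    ext x
    rw [frobeniusPerron_eq_pruned h ((prunedFP α β)^[k] f), Finset.sum_range_succ',
      Function.iterate_succ_apply', add_assoc, add_comm (∑ i ∈ _, _)]
    congr 2
    · simp
    · refine Finset.sum_congr rfl fun i _ => ?_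
      rw [frobeniusPerron_single h (tent_iterate_mem_unit h ⟨h2.le, h3⟩ i),
        Finset.prod_range_succ, Function.iterate_succ_apply',
        show k + 1 - 1 - (i + 1) = k - 1 - i by omega]
      ring

lemma eVariationOn_frobeniusPerron_iterate_le (h : (α, β) ∈ paramRegion) {κ : ℝ}
    (hκ1 : α / β ≤ κ) (hκ2 : (1 - α) / β ≤ κ) (hκ : κ < 1) {f : ℝ → ℝ} {B : ℝ}
    (hB : ∀ i, |(prunedFP α β)^[i] f α| ≤ B) (k : ℕ) (s : Set ℝ) :
    eVariationOn ((frobeniusPerron α β)^[k] f) s ≤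
      eVariationOn ((prunedFP α β)^[k] f) s + ENNReal.ofReal (4 * B / (1 - κ) ^ 2) := by
  obtain ⟨h0, h1, h2, h3, -, -, h6⟩ := paramRegion_bounds h
  have hB0 : 0 ≤ B := (abs_nonneg _).trans (hB 0)
  rw [frobeniusPerron_iterate_eq h]
  refine (eVariationOn_add_le _ _ _).trans (add_le_add le_rfl ?_)
  refine (eVariationOn_finset_sum_le _ _ _).trans ?_
  set m : ℕ → ℝ := fun i => ∏ j ∈ Finset.range i, tentWeight α β ((tent α β)^[j] β) with hm
  have hm0 : ∀ i, 0 ≤ m i := fun i => Finset.prod_nonneg fun _ _ => tentWeight_nonneg h _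
  calc _ ≤ ∑ i ∈ Finset.range k, ENNReal.ofReal (4 * B * m i) := by
        refine Finset.sum_le_sum fun i _ => ?_
        refine (eVariationOn_const_mul _ _ _).trans ?_
        -- The first `2` bounds `1 / β`, since `1 / 2 < β`; the second is the variation of a spike
        -- of height one.
        calc _ ≤ ENNReal.ofReal (2 * B * m i) * 2 := by
              gcongr
              · rw [abs_mul, abs_of_nonneg (hm0 i)]
                refine mul_le_mul_of_nonneg_right ?_ (hm0 i)
                rw [abs_div, abs_of_pos h2, div_le_iff₀ h2]
                nlinarith [hB (k - 1 - i)]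
              · exact eVariationOn_single_le _ _
          _ = ENNReal.ofReal (2 * B * m i) * ENNReal.ofReal 2 := by simp
          _ = _ := by
              rw [← ENNReal.ofReal_mul (mul_nonneg (by positivity) (hm0 i))]
              ring_nf
    _ = ENNReal.ofReal (4 * B * ∑ i ∈ Finset.range k, m i) := by
        rw [Finset.mul_sum, ENNReal.ofReal_sum_of_nonneg]
        exact fun i _ => mul_nonneg (by positivity) (hm0 i)
    _ ≤ _ := by
        refine ENNReal.ofReal_le_ofReal ?_
        rw [div_eq_mul_one_div (4 * B)]
        exact mul_le_mul_of_nonneg_left (sum_prod_tentWeight_le h hκ1 hκ2 hκ k) (by positivity)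

end pointwise

/-! ### Cylinders, and the variation of the iterates of the pruned operator -/

section words

/-- The inverse branch of the tent map with values to the left (`true`) or to the right (`false`)
of the turning point. -/
def branchInv (α β : ℝ) (b : Bool) (x : ℝ) : ℝ :=
  if b then α * x / β else 1 - (1 - α) * x / β

/-- The contraction factor of an inverse branch. -/
def branchRate (α β : ℝ) (b : Bool) : ℝ := if b then α / β else (1 - α) / β

/-- The open half line on either side of the turning point. -/
def branchSide (α : ℝ) (b : Bool) : Set ℝ := if b then Iio α else Ioi α

/-- The inverse branch of an iterate along an itinerary, written with its last letter first. -/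
def wordInv (α β : ℝ) : List Bool → ℝ → ℝ
  | [], x => x
  | b :: w, x => wordInv α β w (branchInv α β b x)

/-- The contraction factor of the inverse branch along an itinerary. -/
def wordRate (α β : ℝ) : List Bool → ℝ
  | [] => 1
  | b :: w => branchRate α β b * wordRate α β w

/-- The domain of the inverse branch along an itinerary. -/
def wordRange (α β : ℝ) : List Bool → Set ℝ
  | [] => Icc 0 1
  | b :: w => Ico 0 β ∩ branchInv α β b ⁻¹' wordRange α β w

/-- The points of `[0,1]` with a given itinerary that avoids the turning point. -/
def cylinder (α β : ℝ) : List Bool → Set ℝ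
  | [] => Icc 0 1
  | b :: w => cylinder α β w ∩ (tent α β)^[w.length] ⁻¹' branchSide α b

/-- The words of a given length. -/
def words : ℕ → Finset (List Bool)
  | 0 => {[]}
  | m + 1 => (words m).image (List.cons true) ∪ (words m).image (List.cons false)

lemma sum_words_succ {M : Type*} [AddCommMonoid M] (m : ℕ) (φ : List Bool → M) :
    ∑ w ∈ words (m + 1), φ w = ∑ w ∈ words m, (φ (true :: w) + φ (false :: w)) := by
  rw [words, Finset.sum_union, Finset.sum_image, Finset.sum_image, Finset.sum_add_distrib]
  · intro a _ b _ h; simpa using h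
  · intro a _ b _ h; simpa using h
  · rw [Finset.disjoint_left]
    intro a ha hb
    simp only [Finset.mem_image] at ha hb
    obtain ⟨_, _, rfl⟩ := ha
    obtain ⟨_, _, h⟩ := hb
    simp at h

lemma length_of_mem_words {m : ℕ} : ∀ {w : List Bool}, w ∈ words m → w.length = m := by
  induction m with
  | zero => intro w hw; simp only [words, Finset.mem_singleton] at hw; simp [hw]
  | succ m ih =>
    intro w hw
    simp only [words, Finset.mem_union, Finset.mem_image] at hw
    rcases hw with ⟨w, hw, rfl⟩ | ⟨w, hw, rfl⟩ <;> simp [ih hw]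

variable {α β κ : ℝ}

lemma tent_eq_iff_of_side (h : (α, β) ∈ paramRegion) (b : Bool) {x y : ℝ}
    (hy : y ∈ Icc (0 : ℝ) 1) :
    y ∈ branchSide α b ∧ tent α β y = x ↔ x ∈ Ico 0 β ∧ branchInv α β b x = y := by
  obtain ⟨h0, h1, h2, -⟩ := paramRegion_bounds h
  have h1' : 0 < 1 - α := by linarith
  cases b
  · simp only [branchSide, branchInv, Bool.false_eq_true, if_false, mem_Ioi, mem_Ico]
    constructor
    · rintro ⟨hyα, rfl⟩
      refine ⟨⟨(tent_mapsTo h hy).1, ?_⟩, ?_⟩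
      · rw [tent_of_ge h hyα.le, div_mul_eq_mul_div, div_lt_iff₀ h1']
        gcongr
      · rw [tent_of_ge h hyα.le]
        field_simp
        ring
    · rintro ⟨⟨hx0, hxβ⟩, rfl⟩
      have h4 : (1 - α) * x / β < 1 - α := by
        rw [div_lt_iff₀ h2]; exact mul_lt_mul_of_pos_left hxβ h1'
      refine ⟨by linarith, ?_⟩
      rw [tent_of_ge h (by linarith)]
      field_simp
      ring
  · simp only [branchSide, branchInv, if_true, mem_Iio, mem_Ico]
    constructor
    · rintro ⟨hyα, rfl⟩
      refine ⟨⟨(tent_mapsTo h hy).1, ?_⟩, ?_⟩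
      · rw [tent_of_le hyα.le, div_mul_eq_mul_div, div_lt_iff₀ h0]
        gcongr
      · rw [tent_of_le hyα.le]
        field_simp
    · rintro ⟨⟨hx0, hxβ⟩, rfl⟩
      have h4 : α * x / β < α := by
        rw [div_lt_iff₀ h2]; exact mul_lt_mul_of_pos_left hxβ h0
      refine ⟨h4, ?_⟩
      rw [tent_of_le h4.le]
      field_simp

lemma cylinder_subset_unit (w : List Bool) : cylinder α β w ⊆ Icc 0 1 := by
  induction w with
  | nil => exact subset_rfl
  | cons b w ih => exact inter_subset_left.trans ih

/-- The iterate of order `w.length` and `wordInv` are inverse bijections between the cylinder and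
`wordRange`. The half-open range `[0, β)` matches itineraries that avoid the turning point. -/
lemma mem_cylinder_iff (h : (α, β) ∈ paramRegion) (w : List Bool) : ∀ x y : ℝ,
    y ∈ cylinder α β w ∧ (tent α β)^[w.length] y = x ↔
      x ∈ wordRange α β w ∧ wordInv α β w x = y := by
  induction w with
  | nil =>
    intro x y
    simp only [cylinder, wordRange, wordInv, List.length_nil, Function.iterate_zero, id]
    constructor <;> rintro ⟨h, rfl⟩ <;> exact ⟨h, rfl⟩
  | cons b w ih =>
    intro x y
    simp only [cylinder, wordRange, wordInv, List.length_cons, Function.iterate_succ_apply',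
      mem_inter_iff, mem_preimage]
    constructor
    · rintro ⟨⟨hy, hs⟩, hx⟩
      have h1 := (tent_eq_iff_of_side h b
        (tent_iterate_mem_unit h (cylinder_subset_unit w hy) w.length)).1 ⟨hs, hx⟩
      have h2 := (ih _ y).1 ⟨hy, rfl⟩
      rw [h1.2]
      exact ⟨⟨h1.1, h2.1⟩, h2.2⟩
    · rintro ⟨⟨hx, hr⟩, hy⟩
      have h2 := (ih _ y).2 ⟨hr, hy⟩
      have h1 := (tent_eq_iff_of_side h b
        (tent_iterate_mem_unit h (cylinder_subset_unit w h2.1) w.length)).2 ⟨hx, h2.2.symm⟩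
      exact ⟨⟨h2.1, h1.1⟩, h1.2⟩

lemma wordInv_mem_cylinder (h : (α, β) ∈ paramRegion) {w : List Bool} {x : ℝ}
    (hx : x ∈ wordRange α β w) : wordInv α β w x ∈ cylinder α β w :=
  ((mem_cylinder_iff h w x _).2 ⟨hx, rfl⟩).1

lemma wordInv_iterate (h : (α, β) ∈ paramRegion) {w : List Bool} {y : ℝ}
    (hy : y ∈ cylinder α β w) : wordInv α β w ((tent α β)^[w.length] y) = y :=
  ((mem_cylinder_iff h w _ y).1 ⟨hy, rfl⟩).2

lemma branchInv_monotone_or_antitone (h : (α, β) ∈ paramRegion) (b : Bool) :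
    Monotone (branchInv α β b) ∨ Antitone (branchInv α β b) := by
  obtain ⟨h0, h1, h2, -⟩ := paramRegion_bounds h
  have h1' : 0 < 1 - α := by linarith
  cases b
  · right
    intro x y hxy
    simp only [branchInv, Bool.false_eq_true, if_false]
    gcongr
  · left
    intro x y hxy
    simp only [branchInv, if_true]
    gcongr

lemma wordInv_monotone_or_antitone (h : (α, β) ∈ paramRegion) (w : List Bool) :
    Monotone (wordInv α β w) ∨ Antitone (wordInv α β w) := by
  induction w with
  | nil => exact Or.inl monotone_id
  | cons b w ih =>
    rcases ih with ih | ih <;> rcases branchInv_monotone_or_antitone h b with hb | hb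
    · exact Or.inl (ih.comp hb)
    · exact Or.inr (ih.comp_antitone hb)
    · exact Or.inr (ih.comp_monotone hb)
    · exact Or.inl (ih.comp hb)

lemma ordConnected_wordRange (h : (α, β) ∈ paramRegion) (w : List Bool) :
    (wordRange α β w).OrdConnected := by
  induction w with
  | nil => exact ordConnected_Icc
  | cons b w ih =>
    refine ordConnected_Ico.inter ?_
    rcases branchInv_monotone_or_antitone h b with hb | hb
    · exact ih.preimage_mono hb
    · exact ih.preimage_anti hb

lemma wordRate_bounds (h : (α, β) ∈ paramRegion) (hκ1 : α / β ≤ κ) (hκ2 : (1 - α) / β ≤ κ)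
    (w : List Bool) : 0 ≤ wordRate α β w ∧ wordRate α β w ≤ κ ^ w.length := by
  obtain ⟨h0, h1, h2, -⟩ := paramRegion_bounds h
  have h1' : 0 < 1 - α := by linarith
  have hb : ∀ b, 0 ≤ branchRate α β b ∧ branchRate α β b ≤ κ := by
    intro b
    cases b
    · simp only [branchRate, Bool.false_eq_true, if_false]
      exact ⟨by positivity, hκ2⟩
    · simp only [branchRate, if_true]
      exact ⟨by positivity, hκ1⟩
  induction w with
  | nil => simp [wordRate]
  | cons b w ih =>
    rw [wordRate, List.length_cons, pow_succ']
    exact ⟨mul_nonneg (hb b).1 ih.1, mul_le_mul (hb b).2 ih.2 ih.1 ((hb b).1.trans (hb b).2)⟩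

lemma branchInv_mem_unit (h : (α, β) ∈ paramRegion) (b : Bool) {x : ℝ} (hx : x ∈ Ico 0 β) :
    branchInv α β b x ∈ Icc (0 : ℝ) 1 := by
  obtain ⟨h0, h1, h2, -⟩ := paramRegion_bounds h
  have h1' : 0 < 1 - α := by linarith
  have hx0 := hx.1
  cases b
  · simp only [branchInv, Bool.false_eq_true, if_false]
    have h4 : (1 - α) * x / β ≤ 1 - α := by
      rw [div_le_iff₀ h2]; exact mul_le_mul_of_nonneg_left hx.2.le h1'.le
    have : 0 ≤ (1 - α) * x / β := by positivity
    constructor <;> linarith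
  · simp only [branchInv, if_true]
    have h4 : α * x / β ≤ α := by
      rw [div_le_iff₀ h2]; exact mul_le_mul_of_nonneg_left hx.2.le h0.le
    exact ⟨by positivity, by linarith⟩

lemma prunedFP_iterate_eq (h : (α, β) ∈ paramRegion) (f : ℝ → ℝ) (m : ℕ) :
    ∀ x ∈ Icc (0 : ℝ) 1, (prunedFP α β)^[m] f x =
      ∑ w ∈ words m,
        wordRate α β w * (wordRange α β w).indicator (fun x => f (wordInv α β w x)) x := by
  induction m with
  | zero =>
    intro x hx
    simp [words, wordRate, wordRange, wordInv, indicator_of_mem hx]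
  | succ m ih =>
    intro x hx
    rw [Function.iterate_succ_apply', sum_words_succ, prunedFP]
    by_cases hxβ : 0 ≤ x ∧ x < β
    · rw [if_pos hxβ]
      have hL := ih _ (branchInv_mem_unit h true hxβ)
      have hR := ih _ (branchInv_mem_unit h false hxβ)
      have eL : branchInv α β true x = α * x / β := by simp [branchInv]
      have eR : branchInv α β false x = 1 - (1 - α) * x / β := by simp [branchInv]
      rw [← eL, ← eR, hL, hR, Finset.mul_sum, Finset.mul_sum, ← Finset.sum_add_distrib]
      refine Finset.sum_congr rfl fun w _ => ?_
      have hb : ∀ b, (wordRange α β (b :: w)).indicator (fun x => f (wordInv α β (b :: w) x)) x =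
          (wordRange α β w).indicator (fun x => f (wordInv α β w x)) (branchInv α β b x) := by
        intro b
        by_cases hm : branchInv α β b x ∈ wordRange α β w
        · rw [indicator_of_mem hm, indicator_of_mem (show x ∈ wordRange α β (b :: w) from ⟨hxβ, hm⟩)]
          rfl
        · rw [indicator_of_notMem hm, indicator_of_notMem]
          exact fun hx => hm hx.2
      rw [hb, hb, wordRate, wordRate]
      simp only [branchRate, if_true, Bool.false_eq_true, if_false]
      ring
    · rw [if_neg hxβ]
      refine (Finset.sum_eq_zero fun w _ => ?_).symm
      rw [indicator_of_notMem fun hx => hxβ hx.1, indicator_of_notMem fun hx => hxβ hx.1]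
      simp

/-- The two subcylinders of a cylinder lie one entirely to the left of the other, because the
inverse branch along `w` is monotone or antitone; variation is superadditive over such pairs. -/
lemma sum_eVariationOn_cylinder_le (h : (α, β) ∈ paramRegion) (f : ℝ → ℝ) (m : ℕ) :
    ∑ w ∈ words m, eVariationOn f (cylinder α β w) ≤ eVariationOn f (Icc 0 1) := by
  induction m with
  | zero => simp [words, cylinder]
  | succ m ih =>
    rw [sum_words_succ]
    refine (Finset.sum_le_sum fun w _ => ?_).trans ih
    have hsub : ∀ b, cylinder α β (b :: w) ⊆ cylinder α β w := fun b => inter_subset_left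
    have hlt : ∀ y ∈ cylinder α β (true :: w), ∀ z ∈ cylinder α β (false :: w),
        (tent α β)^[w.length] y ≤ (tent α β)^[w.length] z := by
      rintro y ⟨-, hy⟩ z ⟨-, hz⟩
      simp only [branchSide, if_true, Bool.false_eq_true, if_false, mem_preimage, mem_Iio,
        mem_Ioi] at hy hz
      exact (hy.trans hz).le
    rcases wordInv_monotone_or_antitone h w with hm | hm
    · refine (eVariationOn.add_le_union f fun y hy z hz => ?_).trans
        (eVariationOn.mono _ (union_subset (hsub _) (hsub _)))
      have := hm (hlt y hy z hz)
      rwa [wordInv_iterate h (hsub _ hy), wordInv_iterate h (hsub _ hz)] at this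
    · rw [add_comm]
      refine (eVariationOn.add_le_union f fun z hz y hy => ?_).trans
        (eVariationOn.mono _ (union_subset (hsub _) (hsub _)))
      have := hm (hlt y hy z hz)
      rwa [wordInv_iterate h (hsub _ hy), wordInv_iterate h (hsub _ hz)] at this

lemma cylinder_eq_inter_open (h : (α, β) ∈ paramRegion) (w : List Bool) :
    ∃ O : Set ℝ, IsOpen O ∧ cylinder α β w = Icc 0 1 ∩ O := by
  induction w with
  | nil => exact ⟨univ, isOpen_univ, by simp [cylinder]⟩
  | cons b w ih =>
    obtain ⟨O, hO, e⟩ := ih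
    refine ⟨O ∩ (tent α β)^[w.length] ⁻¹' branchSide α b,
      hO.inter (IsOpen.preimage ((continuous_tent h).iterate _) ?_), ?_⟩
    · unfold branchSide; split_ifs
      exacts [isOpen_Iio, isOpen_Ioi]
    · rw [cylinder, e, inter_assoc]

lemma measurableSet_cylinder (h : (α, β) ∈ paramRegion) (w : List Bool) :
    MeasurableSet (cylinder α β w) := by
  obtain ⟨O, hO, e⟩ := cylinder_eq_inter_open h w
  rw [e]
  exact measurableSet_Icc.inter hO.measurableSet

lemma sum_lintegral_cylinder_le (h : (α, β) ∈ paramRegion) (f : ℝ → ℝ) (m : ℕ) :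
    ∑ w ∈ words m, ∫⁻ x in cylinder α β w, ‖f x‖ₑ ≤ ∫⁻ x in Icc 0 1, ‖f x‖ₑ := by
  induction m with
  | zero => simp [words, cylinder]
  | succ m ih =>
    rw [sum_words_succ]
    refine (Finset.sum_le_sum fun w _ => ?_).trans ih
    rw [← lintegral_union (measurableSet_cylinder h _)]
    · exact lintegral_mono_set (union_subset inter_subset_left inter_subset_left)
    · rw [disjoint_left]
      rintro y ⟨-, hy⟩ ⟨-, hz⟩
      simp only [branchSide, if_true, Bool.false_eq_true, if_false, mem_preimage, mem_Iio,
        mem_Ioi] at hy hz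
      exact hy.not_gt hz

lemma mem_cylinder_iff_of_mem {w : List Bool} {y y₀ : ℝ} (hy₀ : y₀ ∈ cylinder α β w) :
    y ∈ cylinder α β w ↔ y ∈ Icc (0 : ℝ) 1 ∧ ∀ j < w.length,
      ((tent α β)^[j] y < α ∧ (tent α β)^[j] y₀ < α) ∨
        (α < (tent α β)^[j] y ∧ α < (tent α β)^[j] y₀) := by
  induction w with
  | nil => simp [cylinder]
  | cons b w ih =>
    obtain ⟨h1, h2⟩ := hy₀
    have hside : (tent α β)^[w.length] y ∈ branchSide α b ↔
        ((tent α β)^[w.length] y < α ∧ (tent α β)^[w.length] y₀ < α) ∨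
        (α < (tent α β)^[w.length] y ∧ α < (tent α β)^[w.length] y₀) := by
      cases b
      · simp only [branchSide, Bool.false_eq_true, if_false, mem_Ioi, mem_preimage] at h2 ⊢
        simp [h2, h2.not_gt]
      · simp only [branchSide, if_true, mem_Iio, mem_preimage] at h2 ⊢
        simp [h2, h2.not_gt]
    rw [cylinder, mem_inter_iff, ih h1, mem_preimage, hside, and_assoc, List.length_cons]
    simp only [Nat.lt_succ_iff_lt_or_eq, or_imp, forall_and, forall_eq]

lemma countable_preimage_tent (h : (α, β) ∈ paramRegion) {S : Set ℝ} (hS : S.Countable) :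
    (tent α β ⁻¹' S).Countable := by
  obtain ⟨h0, h1, h2, -⟩ := paramRegion_bounds h
  have h1' : 1 - α ≠ 0 := by linarith
  refine ((hS.image fun x => α * x / β).union (hS.image fun x => 1 - (1 - α) * x / β)).mono ?_
  intro x hx
  rcases le_total x α with hxα | hxα
  · refine Or.inl ⟨_, hx, ?_⟩
    rw [tent_of_le hxα]
    field_simp
  · refine Or.inr ⟨_, hx, ?_⟩
    rw [tent_of_ge h hxα]
    field_simp
    ring

lemma countable_preimage_tent_iterate (h : (α, β) ∈ paramRegion) {S : Set ℝ} (hS : S.Countable)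
    (j : ℕ) : ((tent α β)^[j] ⁻¹' S).Countable := by
  induction j with
  | zero => simpa using hS
  | succ j ih =>
    rw [Function.iterate_succ, preimage_comp]
    exact countable_preimage_tent h ih

/-- A nonempty cylinder is, up to a null set, an element of the cylinder partition. -/
lemma le_volume_cylinder (h : (α, β) ∈ paramRegion) {m : ℕ} (hm : 1 ≤ m) {δ : ℝ}
    (hδ : ∀ I ∈ cylinderPartition α β m, δ ≤ volume.real I) {w : List Bool} (hw : w.length = m)
    {y₀ : ℝ} (hy₀ : y₀ ∈ cylinder α β w) : ENNReal.ofReal δ ≤ volume (cylinder α β w) := by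
  classical
  subst hw
  set I : Fin w.length → Set ℝ := fun j =>
    if (tent α β)^[(j : ℕ)] y₀ < α then Icc 0 α else Icc α 1 with hI
  set A : Set ℝ := ⋂ j : Fin w.length, (tent α β)^[(j : ℕ)] ⁻¹' I j with hA
  have hsub : cylinder α β w ⊆ A := by
    intro y hy
    obtain ⟨hy1, hy2⟩ := (mem_cylinder_iff_of_mem hy₀).1 hy
    refine mem_iInter.2 fun j => ?_
    have hu := tent_iterate_mem_unit h hy1 j
    rcases hy2 j j.2 with ⟨ha, hb⟩ | ⟨ha, hb⟩
    · simp only [hI, if_pos hb, mem_preimage]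
      exact ⟨hu.1, ha.le⟩
    · simp only [hI, if_neg hb.not_gt, mem_preimage]
      exact ⟨ha.le, hu.2⟩
  have hmem : A ∈ cylinderPartition α β w.length := by
    refine ⟨?_, I, fun j => ?_, rfl⟩
    · obtain ⟨O, hO, e⟩ := cylinder_eq_inter_open h w
      rw [e] at hy₀
      -- The cylinder is only relatively open in `[0,1]` and `y₀` may be an endpoint, so an interior
      -- point is found nearby.
      have hcl : y₀ ∈ closure (Ioo (0 : ℝ) 1) := by
        rw [closure_Ioo zero_ne_one]; exact hy₀.1
      obtain ⟨z, hzO, hz⟩ := mem_closure_iff.1 hcl O hO hy₀.2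
      refine ⟨z, mem_interior.2 ⟨O ∩ Ioo 0 1, fun x hx => hsub ?_, hO.inter isOpen_Ioo, hzO, hz⟩⟩
      rw [e]
      exact ⟨Ioo_subset_Icc_self hx.2, hx.1⟩
    · simp only [hI, basePartition]
      split_ifs <;> simp
  have hcover : A ⊆ cylinder α β w ∪ ⋃ j : ℕ, (tent α β)^[j] ⁻¹' {α} := by
    intro y hy
    by_cases hbad : ∃ j : ℕ, (tent α β)^[j] y = α
    · exact Or.inr (mem_iUnion.2 hbad)
    push Not at hbad
    refine Or.inl ((mem_cylinder_iff_of_mem hy₀).2 ⟨?_, fun j hj => ?_⟩)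
    · obtain ⟨h1, h2, -⟩ := paramRegion_bounds h
      -- The condition at time zero confines the points to `[0,1]`; this is where `1 ≤ m` matters.
      have hI0 : I ⟨0, hm⟩ ⊆ Icc 0 1 := by
        simp only [hI]
        split_ifs
        exacts [Icc_subset_Icc_right h2.le, Icc_subset_Icc_left h1.le]
      exact hI0 (mem_iInter.1 hy ⟨0, hm⟩)
    · have h0 := mem_iInter.1 hy ⟨j, hj⟩
      have h0' := (mem_cylinder_iff_of_mem hy₀).1 hy₀
      simp only [hI, mem_preimage] at h0
      rcases h0'.2 j hj with ⟨-, hb⟩ | ⟨-, hb⟩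
      · rw [if_pos hb] at h0
        exact Or.inl ⟨lt_of_le_of_ne h0.2 (hbad j), hb⟩
      · rw [if_neg hb.not_gt] at h0
        exact Or.inr ⟨lt_of_le_of_ne h0.1 (hbad j).symm, hb⟩
  have hnull : volume (⋃ j : ℕ, (tent α β)^[j] ⁻¹' {α}) = 0 :=
    (countable_iUnion fun j =>
      countable_preimage_tent_iterate h (countable_singleton α) j).measure_zero _
  calc ENNReal.ofReal δ ≤ ENNReal.ofReal (volume.real A) := ENNReal.ofReal_le_ofReal (hδ A hmem)
    _ ≤ volume A := ENNReal.ofReal_toReal_le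
    _ ≤ volume (cylinder α β w) + volume (⋃ j : ℕ, (tent α β)^[j] ⁻¹' {α}) :=
      (measure_mono hcover).trans (measure_union_le _ _)
    _ = _ := by rw [hnull, add_zero]

/-- Average the inequality `|f x| ≤ |f x - f y| + |f y|` over `y` in `J`. -/
lemma enorm_le_eVariationOn_add {f : ℝ → ℝ} {J : Set ℝ} (hJ : MeasurableSet J) {d : ℝ≥0∞}
    (hd0 : d ≠ 0) (hd : d ≤ volume J) (hJ' : volume J ≠ ∞) {x : ℝ} (hx : x ∈ J) :
    ‖f x‖ₑ ≤ eVariationOn f J + d⁻¹ * ∫⁻ y in J, ‖f y‖ₑ := by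
  have hv0 : volume J ≠ 0 := (pos_iff_ne_zero.2 hd0 |>.trans_le hd).ne'
  have hle : ‖f x‖ₑ * volume J ≤ eVariationOn f J * volume J + ∫⁻ y in J, ‖f y‖ₑ := by
    calc _ = ∫⁻ _ in J, ‖f x‖ₑ := by rw [setLIntegral_const]
      _ ≤ ∫⁻ y in J, (eVariationOn f J + ‖f y‖ₑ) := by
        refine setLIntegral_mono' hJ fun y hy => ?_
        calc ‖f x‖ₑ = edist (f x) 0 := (edist_zero_right _).symm
          _ ≤ edist (f x) (f y) + edist (f y) 0 := edist_triangle _ _ _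
          _ ≤ _ := by
            rw [edist_zero_right]
            gcongr
            exact eVariationOn.edist_le f hx hy
      _ = _ := by rw [lintegral_add_left measurable_const, setLIntegral_const]
  calc ‖f x‖ₑ = ‖f x‖ₑ * volume J * (volume J)⁻¹ := by
        rw [mul_assoc, ENNReal.mul_inv_cancel hv0 hJ', mul_one]
    _ ≤ (eVariationOn f J * volume J + ∫⁻ y in J, ‖f y‖ₑ) * (volume J)⁻¹ := by gcongr
    _ = eVariationOn f J + (volume J)⁻¹ * ∫⁻ y in J, ‖f y‖ₑ := by
        rw [add_mul, mul_assoc, ENNReal.mul_inv_cancel hv0 hJ', mul_one, mul_comm (∫⁻ y in J, _)]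
    _ ≤ _ := by gcongr

/-- The Lasota-Yorke inequality for the pruned Frobenius-Perron operator. -/
lemma eVariationOn_prunedFP_iterate_le (h : (α, β) ∈ paramRegion) (hκ1 : α / β ≤ κ)
    (hκ2 : (1 - α) / β ≤ κ) {m : ℕ} (hm : 1 ≤ m) {δ : ℝ} (hδ0 : 0 < δ)
    (hδ : ∀ I ∈ cylinderPartition α β m, δ ≤ volume.real I) (f : ℝ → ℝ) :
    eVariationOn ((prunedFP α β)^[m] f) (Icc 0 1) ≤
      ENNReal.ofReal (κ ^ m) * (3 * eVariationOn f (Icc 0 1) +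
        2 * (ENNReal.ofReal δ)⁻¹ * ∫⁻ x in Icc 0 1, ‖f x‖ₑ) := by
  rw [eVariationOn.congr fun x hx => prunedFP_iterate_eq h f m x hx]
  refine (eVariationOn_finset_sum_le _ _ _).trans ?_
  have hδ' : ENNReal.ofReal δ ≠ 0 := by simpa using hδ0
  calc _ ≤ ∑ w ∈ words m, ENNReal.ofReal (κ ^ m) * (3 * eVariationOn f (cylinder α β w) +
        2 * (ENNReal.ofReal δ)⁻¹ * ∫⁻ x in cylinder α β w, ‖f x‖ₑ) := by
        refine Finset.sum_le_sum fun w hw => (eVariationOn_const_mul _ _ _).trans ?_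
        have hlen := length_of_mem_words hw
        obtain ⟨hr0, hr1⟩ := wordRate_bounds h hκ1 hκ2 w
        rw [abs_of_nonneg hr0]
        refine mul_le_mul' (ENNReal.ofReal_le_ofReal (hlen ▸ hr1)) ?_
        have hmaps : MapsTo (wordInv α β w) (wordRange α β w) (cylinder α β w) :=
          fun x hx => wordInv_mem_cylinder h hx
        have hV : eVariationOn (fun x => f (wordInv α β w x)) (wordRange α β w) ≤
            eVariationOn f (cylinder α β w) := by
          rcases wordInv_monotone_or_antitone h w with hmon | hmon
          · exact eVariationOn.comp_le_of_monotoneOn f _ (hmon.monotoneOn _) hmaps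
          · exact eVariationOn.comp_le_of_antitoneOn f _ (hmon.antitoneOn _) hmaps
        -- One variation from inside the range and two from the cuts give the factor `3`. The cut
        -- bound is needed only at points of the range, so empty cylinders require no length bound.
        refine (eVariationOn_indicator_ordConnected (ordConnected_wordRange h w)
          (b := eVariationOn f (cylinder α β w) +
            (ENNReal.ofReal δ)⁻¹ * ∫⁻ y in cylinder α β w, ‖f y‖ₑ) fun x hx => ?_).trans ?_
        · rw [edist_zero_right]
          refine enorm_le_eVariationOn_add (measurableSet_cylinder h w) hδ'
            (le_volume_cylinder h hm hδ hlen (hmaps hx)) ?_ (hmaps hx)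
          exact measure_ne_top_of_subset (cylinder_subset_unit w) (by simp)
        · calc _ ≤ eVariationOn f (cylinder α β w) + 2 * (eVariationOn f (cylinder α β w) +
                (ENNReal.ofReal δ)⁻¹ * ∫⁻ y in cylinder α β w, ‖f y‖ₑ) := by gcongr
            _ = _ := by ring
    _ = ENNReal.ofReal (κ ^ m) * (3 * ∑ w ∈ words m, eVariationOn f (cylinder α β w) +
        2 * (ENNReal.ofReal δ)⁻¹ * ∑ w ∈ words m, ∫⁻ x in cylinder α β w, ‖f x‖ₑ) := by
        rw [← Finset.mul_sum, Finset.sum_add_distrib, ← Finset.mul_sum, ← Finset.mul_sum]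
    _ ≤ _ := by
        gcongr
        · exact sum_eVariationOn_cylinder_le h f m
        · exact sum_lintegral_cylinder_le h f m

end words

/-! ### Integral properties of the Frobenius-Perron operator -/

section integral

variable {α β κ : ℝ}

instance : IsProbabilityMeasure lebUnit := ⟨by simp [lebUnit]⟩

lemma integrable_lebUnit_iff {f : ℝ → ℝ} :
    Integrable f lebUnit ↔ IntervalIntegrable f volume 0 1 :=
  (intervalIntegrable_iff_integrableOn_Icc_of_le zero_le_one).symm

lemma integral_lebUnit (f : ℝ → ℝ) : ∫ x, f x ∂lebUnit = ∫ x in (0 : ℝ)..1, f x := by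
  rw [intervalIntegral.integral_of_le zero_le_one, ← integral_Icc_eq_integral_Ioc]; rfl

lemma intervalIntegrable_branches (h : (α, β) ∈ paramRegion) {f : ℝ → ℝ}
    (hf : Integrable f lebUnit) :
    (IntervalIntegrable (fun x => α / β * f (α * x / β)) volume 0 β ∧
      ∫ x in (0 : ℝ)..β, α / β * f (α * x / β) = ∫ x in (0 : ℝ)..α, f x) ∧
    (IntervalIntegrable (fun x => (1 - α) / β * f (1 - (1 - α) * x / β)) volume 0 β ∧
      ∫ x in (0 : ℝ)..β, (1 - α) / β * f (1 - (1 - α) * x / β) = ∫ x in α..1, f x) := by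
  obtain ⟨h0, h1, h2, -⟩ := paramRegion_bounds h
  have h1' : 0 < 1 - α := by linarith
  rw [integrable_lebUnit_iff] at hf
  have hL : IntervalIntegrable f volume 0 α := hf.mono_set (by
    rw [uIcc_of_le h0.le, uIcc_of_le zero_le_one]; exact Icc_subset_Icc_right h1.le)
  have hR : IntervalIntegrable f volume α 1 := hf.mono_set (by
    rw [uIcc_of_le h1.le, uIcc_of_le zero_le_one]; exact Icc_subset_Icc_left h0.le)
  have hcL : α / β ≠ 0 := by positivity
  have hcR : (1 - α) / β ≠ 0 := by positivity
  have eL : ∀ x, α * x / β = α / β * x := fun x => by ring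
  have eR : ∀ x, 1 - (1 - α) * x / β = 1 - (1 - α) / β * x := fun x => by ring
  simp only [eL, eR]
  refine ⟨⟨?_, ?_⟩, ?_, ?_⟩
  · have := hL.comp_mul_left (c := α / β)
    rw [zero_div, show α / (α / β) = β by field_simp] at this
    exact this.const_mul _
  · rw [intervalIntegral.integral_const_mul, intervalIntegral.integral_comp_mul_left _ hcL,
      smul_eq_mul, ← mul_assoc, mul_inv_cancel₀ hcL, one_mul, mul_zero,
      div_mul_cancel₀ _ h2.ne']
  · have := (hR.comp_sub_left 1).comp_mul_left (c := (1 - α) / β)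
    rw [show (1 - α) / ((1 - α) / β) = β by field_simp, sub_self, zero_div] at this
    exact this.symm.const_mul _
  · rw [intervalIntegral.integral_const_mul, intervalIntegral.integral_comp_sub_mul _ hcR,
      smul_eq_mul, ← mul_assoc, mul_inv_cancel₀ hcR, one_mul, mul_zero, sub_zero,
      div_mul_cancel₀ _ h2.ne', sub_sub_cancel]

lemma frobeniusPerron_integrable_and_integral (h : (α, β) ∈ paramRegion) {f : ℝ → ℝ}
    (hf : Integrable f lebUnit) : Integrable (frobeniusPerron α β f) lebUnit ∧
      ∫ x, frobeniusPerron α β f x ∂lebUnit = ∫ x, f x ∂lebUnit := by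
  obtain ⟨⟨hL, hL'⟩, hR, hR'⟩ := intervalIntegrable_branches h hf
  obtain ⟨h0, h1, h2, h3, -⟩ := paramRegion_bounds h
  rw [integrable_lebUnit_iff] at hf
  have hfL : IntervalIntegrable f volume 0 α := hf.mono_set (by
    rw [uIcc_of_le h0.le, uIcc_of_le zero_le_one]; exact Icc_subset_Icc_right h1.le)
  have hfR : IntervalIntegrable f volume α 1 := hf.mono_set (by
    rw [uIcc_of_le h1.le, uIcc_of_le zero_le_one]; exact Icc_subset_Icc_left h0.le)
  have e1 : EqOn (fun x => α / β * f (α * x / β) + (1 - α) / β * f (1 - (1 - α) * x / β))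
      (frobeniusPerron α β f) (uIoc 0 β) := by
    intro x hx
    rw [uIoc_of_le h2.le] at hx
    exact (if_pos ⟨hx.1.le, hx.2⟩).symm
  have e2 : EqOn (fun _ => (0 : ℝ)) (frobeniusPerron α β f) (uIoc β 1) := by
    intro x hx
    rw [uIoc_of_le h3] at hx
    exact (if_neg fun hh => hx.1.not_ge hh.2).symm
  have i1 : IntervalIntegrable (frobeniusPerron α β f) volume 0 β :=
    (hL.add hR).congr e1
  have i2 : IntervalIntegrable (frobeniusPerron α β f) volume β 1 :=
    (intervalIntegrable_const (c := (0 : ℝ))).congr e2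
  refine ⟨integrable_lebUnit_iff.2 (i1.trans i2), ?_⟩
  rw [integral_lebUnit, integral_lebUnit, ← intervalIntegral.integral_add_adjacent_intervals i1 i2,
    ← intervalIntegral.integral_congr_ae (.of_forall fun x hx => e1 hx),
    ← intervalIntegral.integral_congr_ae (.of_forall fun x hx => e2 hx),
    intervalIntegral.integral_add hL hR, hL', hR',
    intervalIntegral.integral_add_adjacent_intervals hfL hfR]
  simp

/-- The map undoes both inverse branches, so `φ ∘ T` factors out. With conservation of the integral
this yields the duality `integral_frobeniusPerron_mul`. -/
lemma frobeniusPerron_mul_comp (h : (α, β) ∈ paramRegion) (f φ : ℝ → ℝ) (x : ℝ) :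
    frobeniusPerron α β (fun y => f y * φ (tent α β y)) x = frobeniusPerron α β f x * φ x := by
  obtain ⟨h0, h1, h2, -⟩ := paramRegion_bounds h
  have h1' : 0 < 1 - α := by linarith
  unfold frobeniusPerron
  split_ifs with hx
  · have hL : tent α β (α * x / β) = x := by
      have : α * x / β ≤ α := by
        rw [div_le_iff₀ h2]; exact mul_le_mul_of_nonneg_left hx.2 h0.le
      rw [tent_of_le this]
      field_simp
    have hR : tent α β (1 - (1 - α) * x / β) = x := by
      have h4 : (1 - α) * x / β ≤ 1 - α := by
        rw [div_le_iff₀ h2]; exact mul_le_mul_of_nonneg_left hx.2 h1'.le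
      rw [tent_of_ge h (by linarith)]
      field_simp
      ring
    simp only [hL, hR]
    ring
  · simp

lemma integral_frobeniusPerron_mul (h : (α, β) ∈ paramRegion) {f φ : ℝ → ℝ}
    (hf : Integrable (fun y => f y * φ (tent α β y)) lebUnit) :
    ∫ x, frobeniusPerron α β f x * φ x ∂lebUnit = ∫ x, f x * φ (tent α β x) ∂lebUnit := by
  simp only [← frobeniusPerron_mul_comp h]
  exact (frobeniusPerron_integrable_and_integral h hf).2

lemma lintegral_enorm_frobeniusPerron_le (h : (α, β) ∈ paramRegion) {f : ℝ → ℝ}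
    (hf : Integrable f lebUnit) :
    ∫⁻ x, ‖frobeniusPerron α β f x‖ₑ ∂lebUnit ≤ ∫⁻ x, ‖f x‖ₑ ∂lebUnit := by
  obtain ⟨h0, h1, h2, -⟩ := paramRegion_bounds h
  have h1' : 0 < 1 - α := by linarith
  have hP := frobeniusPerron_integrable_and_integral h hf
  have hPabs := frobeniusPerron_integrable_and_integral h hf.norm
  rw [← ofReal_integral_norm_eq_lintegral_enorm hP.1, ← ofReal_integral_norm_eq_lintegral_enorm hf,
    ← hPabs.2]
  refine ENNReal.ofReal_le_ofReal (integral_mono hP.1.norm hPabs.1 fun x => ?_)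
  simp only [frobeniusPerron, Real.norm_eq_abs]
  split_ifs
  · refine (abs_add_le _ _).trans (le_of_eq ?_)
    rw [abs_mul, abs_mul, abs_of_pos (div_pos h0 h2), abs_of_pos (div_pos h1' h2)]
  · simp

lemma frobeniusPerron_sub (f g : ℝ → ℝ) :
    frobeniusPerron α β (fun x => f x - g x) =
      fun x => frobeniusPerron α β f x - frobeniusPerron α β g x := by
  ext x
  unfold frobeniusPerron
  split_ifs <;> ring

lemma prunedFP_ae_eq (h : (α, β) ∈ paramRegion) (f : ℝ → ℝ) :
    prunedFP α β f =ᵐ[lebUnit] frobeniusPerron α β f := by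
  have : ∀ᵐ x ∂lebUnit, x ≠ β := by
    refine ae_restrict_of_ae ?_
    simp [ae_iff]
  filter_upwards [this] with x hx
  rw [frobeniusPerron_eq_pruned h]
  simp [hx]

lemma integrable_prunedFP (h : (α, β) ∈ paramRegion) {f : ℝ → ℝ} (hf : Integrable f lebUnit) :
    Integrable (prunedFP α β f) lebUnit :=
  (frobeniusPerron_integrable_and_integral h hf).1.congr (prunedFP_ae_eq h f).symm

lemma integrable_prunedFP_iterate (h : (α, β) ∈ paramRegion) {f : ℝ → ℝ}
    (hf : Integrable f lebUnit) (k : ℕ) : Integrable ((prunedFP α β)^[k] f) lebUnit := by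
  induction k with
  | zero => exact hf
  | succ k ih => rw [Function.iterate_succ_apply']; exact integrable_prunedFP h ih

lemma lintegral_enorm_prunedFP_iterate_le (h : (α, β) ∈ paramRegion) {f : ℝ → ℝ}
    (hf : Integrable f lebUnit) (k : ℕ) :
    ∫⁻ x, ‖(prunedFP α β)^[k] f x‖ₑ ∂lebUnit ≤ ∫⁻ x, ‖f x‖ₑ ∂lebUnit := by
  induction k with
  | zero => rfl
  | succ k ih =>
    rw [Function.iterate_succ_apply']
    refine le_trans (le_of_eq (lintegral_congr_ae ?_)) ((lintegral_enorm_frobeniusPerron_le h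
      (integrable_prunedFP_iterate h hf k)).trans ih)
    filter_upwards [prunedFP_ae_eq h ((prunedFP α β)^[k] f)] with x hx
    rw [hx]

/-- The Frobenius-Perron operator contracts the `L¹` norm and fixes `f`, and pruning changes it only
on a null set. -/
lemma lintegral_enorm_sub_prunedFP_iterate_le (h : (α, β) ∈ paramRegion) {f g : ℝ → ℝ}
    (hf : Integrable f lebUnit) (hfix : frobeniusPerron α β f =ᵐ[lebUnit] f)
    (hg : Integrable g lebUnit) (k : ℕ) :
    ∫⁻ x, ‖f x - (prunedFP α β)^[k] g x‖ₑ ∂lebUnit ≤ ∫⁻ x, ‖f x - g x‖ₑ ∂lebUnit := by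
  induction k with
  | zero => rfl
  | succ k ih =>
    rw [Function.iterate_succ_apply']
    refine le_trans (le_of_eq (lintegral_congr_ae ?_)) ((lintegral_enorm_frobeniusPerron_le h
      (hf.sub (integrable_prunedFP_iterate h hg k))).trans ih)
    filter_upwards [prunedFP_ae_eq h ((prunedFP α β)^[k] g), hfix] with x hx hx'
    rw [hx, show (f - (prunedFP α β)^[k] g) = fun x => f x - (prunedFP α β)^[k] g x from rfl,
      frobeniusPerron_sub]
    simp only [hx']

lemma enorm_le_eVariationOn_add_lintegral (f : ℝ → ℝ) {x : ℝ} (hx : x ∈ Icc (0 : ℝ) 1) :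
    ‖f x‖ₑ ≤ eVariationOn f (Icc 0 1) + ∫⁻ y, ‖f y‖ₑ ∂lebUnit := by
  have := enorm_le_eVariationOn_add (f := f) (J := Icc (0 : ℝ) 1) measurableSet_Icc
    (d := 1) one_ne_zero (by simp) (by simp) hx
  rw [inv_one, one_mul] at this
  exact this

end integral

/-! ### Iterating the Lasota-Yorke inequality -/

section iteration

variable {α β : ℝ} {m : ℕ} {D : ℝ≥0∞}

/-- The Lasota-Yorke inequalities for one and for `m` steps, with a common constant. -/
def LasotaYorke (α β : ℝ) (m : ℕ) (D : ℝ≥0∞) : Prop :=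
  ∀ f : ℝ → ℝ,
    eVariationOn (prunedFP α β f) (Icc 0 1) ≤
      3 * eVariationOn f (Icc 0 1) + D * ∫⁻ x, ‖f x‖ₑ ∂lebUnit ∧
    eVariationOn ((prunedFP α β)^[m] f) (Icc 0 1) ≤
      2⁻¹ * eVariationOn f (Icc 0 1) + D * ∫⁻ x, ‖f x‖ₑ ∂lebUnit

lemma LasotaYorke.eVariationOn_iterate_mul_le (hLY : LasotaYorke α β m D)
    (h : (α, β) ∈ paramRegion) {f : ℝ → ℝ} (hf : Integrable f lebUnit) (j : ℕ) :
    eVariationOn ((prunedFP α β)^[m * j] f) (Icc 0 1) ≤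
      2⁻¹ ^ j * eVariationOn f (Icc 0 1) + 2 * D * ∫⁻ x, ‖f x‖ₑ ∂lebUnit := by
  induction j with
  | zero => simp
  | succ j ih =>
    rw [mul_add, mul_one, add_comm, Function.iterate_add_apply]
    have e2 : (2 : ℝ≥0∞)⁻¹ * 2 = 1 := ENNReal.inv_mul_cancel (by simp) (by simp)
    calc _ ≤ 2⁻¹ * eVariationOn ((prunedFP α β)^[m * j] f) (Icc 0 1) +
          D * ∫⁻ x, ‖(prunedFP α β)^[m * j] f x‖ₑ ∂lebUnit := (hLY _).2
      _ ≤ 2⁻¹ * (2⁻¹ ^ j * eVariationOn f (Icc 0 1) + 2 * D * ∫⁻ x, ‖f x‖ₑ ∂lebUnit) +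
          D * ∫⁻ x, ‖f x‖ₑ ∂lebUnit := by
        exact add_le_add (mul_le_mul' le_rfl ih)
          (mul_le_mul' le_rfl (lintegral_enorm_prunedFP_iterate_le h hf _))
      _ = 2⁻¹ ^ (j + 1) * eVariationOn f (Icc 0 1) +
          (2⁻¹ * 2 + 1) * (D * ∫⁻ x, ‖f x‖ₑ ∂lebUnit) := by ring
      _ = _ := by rw [e2, one_add_one_eq_two, mul_assoc]

lemma LasotaYorke.eVariationOn_iterate_le_pow (hLY : LasotaYorke α β m D)
    (h : (α, β) ∈ paramRegion) {f : ℝ → ℝ} (hf : Integrable f lebUnit) (r : ℕ) :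
    eVariationOn ((prunedFP α β)^[r] f) (Icc 0 1) ≤
      4 ^ r * (eVariationOn f (Icc 0 1) + D * ∫⁻ x, ‖f x‖ₑ ∂lebUnit) := by
  induction r with
  | zero => simp
  | succ r ih =>
    rw [Function.iterate_succ_apply']
    set X := eVariationOn f (Icc 0 1) + D * ∫⁻ x, ‖f x‖ₑ ∂lebUnit with hX
    have h4 : (1 : ℝ≥0∞) ≤ 4 ^ r := one_le_pow₀ (by norm_num)
    calc _ ≤ 3 * eVariationOn ((prunedFP α β)^[r] f) (Icc 0 1) +
          D * ∫⁻ x, ‖(prunedFP α β)^[r] f x‖ₑ ∂lebUnit := (hLY _).1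
      _ ≤ 3 * (4 ^ r * X) + D * ∫⁻ x, ‖f x‖ₑ ∂lebUnit := by
        exact add_le_add (mul_le_mul' le_rfl ih)
          (mul_le_mul' le_rfl (lintegral_enorm_prunedFP_iterate_le h hf _))
      _ ≤ 3 * (4 ^ r * X) + 4 ^ r * X := by
        refine add_le_add le_rfl ?_
        calc _ ≤ X := le_add_self
          _ = 1 * X := (one_mul _).symm
          _ ≤ _ := by gcongr
      _ = 4 ^ (r + 1) * X := by ring

lemma LasotaYorke.eVariationOn_iterate_le (hLY : LasotaYorke α β m D) (hm : 1 ≤ m)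
    (h : (α, β) ∈ paramRegion) {f : ℝ → ℝ} (hf : Integrable f lebUnit) (k : ℕ) :
    eVariationOn ((prunedFP α β)^[k] f) (Icc 0 1) ≤
      4 ^ m * (eVariationOn f (Icc 0 1) + D * ∫⁻ x, ‖f x‖ₑ ∂lebUnit) +
        2 * D * ∫⁻ x, ‖f x‖ₑ ∂lebUnit := by
  -- The `k % m` single steps act first, at a cost bounded by `4 ^ m`; the blocks of length `m` then
  -- contract.
  rw [← Nat.div_add_mod k m, Function.iterate_add_apply]
  refine (hLY.eVariationOn_iterate_mul_le h (integrable_prunedFP_iterate h hf _) _).trans ?_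
  refine add_le_add ?_ ?_
  · calc _ ≤ 1 * eVariationOn ((prunedFP α β)^[k % m] f) (Icc 0 1) := by
          gcongr
          exact pow_le_one₀ (by simp) (by simp)
      _ ≤ 4 ^ (k % m) * (eVariationOn f (Icc 0 1) + D * ∫⁻ x, ‖f x‖ₑ ∂lebUnit) := by
          rw [one_mul]
          exact hLY.eVariationOn_iterate_le_pow h hf _
      _ ≤ _ := by
          gcongr
          · norm_num
          · exact (Nat.mod_lt k (by omega)).le
  · exact mul_le_mul' le_rfl (lintegral_enorm_prunedFP_iterate_le h hf _)

end iteration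

/-- Under the uniform lower bound on the lengths of the cylinders, the Lasota-Yorke inequalities
hold with uniform constants along the sequence. -/
lemma exists_lasotaYorke {α β : ℕ → ℝ} (hU : ∀ n, (α n, β n) ∈ paramRegion)
    (hpart : ∀ m : ℕ, 1 ≤ m → ∃ δ : ℝ, 0 < δ ∧
      ∀ n, ∀ I ∈ cylinderPartition (α n) (β n) m, δ ≤ volume.real I) {κ : ℝ} (hκ0 : 0 ≤ κ)
    (hκ : κ < 1) (hκ1 : ∀ n, α n / β n ≤ κ) (hκ2 : ∀ n, (1 - α n) / β n ≤ κ) :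
    ∃ m : ℕ, ∃ D : ℝ≥0, 1 ≤ m ∧ ∀ n, LasotaYorke (α n) (β n) m D := by
  -- The threshold `1 / 6` turns the factor `3 κ ^ m` into at most `1 / 2`.
  obtain ⟨m, hm⟩ := exists_pow_lt_of_lt_one (show (0 : ℝ) < 1 / 6 by norm_num) hκ
  have hm1 : 1 ≤ m := by
    rcases Nat.eq_zero_or_pos m with rfl | h
    · norm_num at hm
    · exact h
  obtain ⟨δ, hδ0, hδ⟩ := hpart m hm1
  obtain ⟨δ', hδ0', hδ'⟩ := hpart 1 le_rfl
  have hfin : ∀ d : ℝ, 0 < d → 2 * (ENNReal.ofReal d)⁻¹ ≠ ∞ := fun d hd =>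
    ENNReal.mul_ne_top (by simp) (by simpa using hd)
  refine ⟨m, (2 * (ENNReal.ofReal δ)⁻¹ + 2 * (ENNReal.ofReal δ')⁻¹).toNNReal, hm1,
    fun n f => ?_⟩
  rw [ENNReal.coe_toNNReal (ENNReal.add_ne_top.2 ⟨hfin δ hδ0, hfin δ' hδ0'⟩)]
  constructor
  · refine (eVariationOn_prunedFP_iterate_le (hU n) (hκ1 n) (hκ2 n) le_rfl hδ0' (hδ' n) f).trans ?_
    calc _ ≤ 1 * (3 * eVariationOn f (Icc 0 1) +
          2 * (ENNReal.ofReal δ')⁻¹ * ∫⁻ x in Icc 0 1, ‖f x‖ₑ) := by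
          gcongr
          simpa using hκ.le
      _ ≤ _ := by
          rw [one_mul]
          gcongr
          · exact le_add_self
          · exact le_rfl
  · refine (eVariationOn_prunedFP_iterate_le (hU n) (hκ1 n) (hκ2 n) hm1 hδ0 (hδ n) f).trans ?_
    rw [mul_add]
    refine add_le_add ?_ ?_
    · rw [← mul_assoc]
      gcongr
      calc _ ≤ ENNReal.ofReal (1 / 6) * ENNReal.ofReal 3 := by
            gcongr
            simp
        _ = ENNReal.ofReal (2⁻¹) := by
            rw [← ENNReal.ofReal_mul (by norm_num)]
            norm_num
        _ ≤ _ := by rw [ENNReal.ofReal_inv_of_pos two_pos]; simp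
    · calc _ ≤ 1 * (2 * (ENNReal.ofReal δ)⁻¹ * ∫⁻ x in Icc 0 1, ‖f x‖ₑ) := by
            gcongr
            simpa using pow_le_one₀ hκ0 hκ.le
        _ ≤ _ := by
            rw [one_mul]
            gcongr
            · exact le_self_add
            · exact le_rfl

/-! ### Compactness in `L¹` of sets of functions of bounded variation -/

section compactness

/-- The classes of functions whose variation and sup norm are at most `C`. -/
def bvSet (C : ℝ≥0) : Set (ℝ →₁[lebUnit] ℝ) :=
  {F | ∃ h : ℝ → ℝ, F =ᵐ[lebUnit] h ∧ eVariationOn h (Icc 0 1) ≤ C ∧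
    ∀ x ∈ Icc (0 : ℝ) 1, ‖h x‖ₑ ≤ C}

lemma edist_eq_lintegral_of_ae_eq {F G : ℝ →₁[lebUnit] ℝ} {f g : ℝ → ℝ} (hF : F =ᵐ[lebUnit] f)
    (hG : G =ᵐ[lebUnit] g) : edist F G = ∫⁻ x, ‖f x - g x‖ₑ ∂lebUnit := by
  rw [L1.edist_def]
  refine lintegral_congr_ae ?_
  filter_upwards [hF, hG] with x h1 h2
  rw [h1, h2, edist_eq_enorm_sub]

/-- The points of `[0,1)` in the `j`-th of `N` intervals of equal length. -/
def gridCell (N j : ℕ) : Set ℝ := {x | ⌊(N : ℝ) * x⌋₊ = j}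

lemma measurableSet_gridCell (N j : ℕ) : MeasurableSet (gridCell N j) :=
  (Nat.measurable_floor.comp (measurable_const_mul (N : ℝ))) (measurableSet_singleton j)

lemma mem_Icc_of_mem_gridCell {N j : ℕ} (hN : 1 ≤ N) {x : ℝ} (hx0 : 0 ≤ x)
    (hx : x ∈ gridCell N j) : x ∈ Icc ((j : ℝ) / N) (((j + 1 : ℕ) : ℝ) / N) := by
  have hN' : (0 : ℝ) < N := by exact_mod_cast hN
  have hx' : ⌊(N : ℝ) * x⌋₊ = j := hx
  have h0 : 0 ≤ (N : ℝ) * x := by positivity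
  constructor
  · rw [div_le_iff₀ hN', mul_comm, ← hx']
    exact Nat.floor_le h0
  · rw [le_div_iff₀ hN', mul_comm, ← hx']
    push_cast
    exact (Nat.lt_floor_add_one _).le

lemma lebUnit_gridCell_le {N : ℕ} (hN : 1 ≤ N) (j : ℕ) : lebUnit (gridCell N j) ≤ (N : ℝ≥0∞)⁻¹ := by
  have hN' : (0 : ℝ) < N := by exact_mod_cast hN
  rw [lebUnit, Measure.restrict_apply (measurableSet_gridCell N j)]
  calc _ ≤ volume (Icc ((j : ℝ) / N) (((j + 1 : ℕ) : ℝ) / N)) :=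
        measure_mono fun x hx => mem_Icc_of_mem_gridCell hN hx.2.1 hx.1
    _ = ENNReal.ofReal ((N : ℝ)⁻¹) := by
        rw [Real.volume_Icc]
        congr 1
        push_cast
        field_simp
        ring
    _ = _ := by rw [ENNReal.ofReal_inv_of_pos hN', ENNReal.ofReal_natCast]

/-- The step function on the grid of mesh `1 / N` with given values. -/
def gridStep (N : ℕ) (c : ℕ → ℝ) : ℝ →₁[lebUnit] ℝ :=
  ∑ j ∈ Finset.range N,
    c j • indicatorConstLp 1 (measurableSet_gridCell N j) (measure_ne_top lebUnit _) (1 : ℝ)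

lemma continuous_gridStep (N : ℕ) : Continuous (gridStep N) := by
  unfold gridStep
  exact continuous_finsetSum _ fun j _ => (continuous_apply j).smul continuous_const

lemma coeFn_gridStep (N : ℕ) (c : ℕ → ℝ) : gridStep N c =ᵐ[lebUnit]
    fun x => ∑ j ∈ Finset.range N, (gridCell N j).indicator (fun _ => c j) x := by
  unfold gridStep
  generalize Finset.range N = t
  classical
  induction t using Finset.induction_on with
  | empty =>
    simp only [Finset.sum_empty]
    exact Lp.coeFn_zero ℝ 1 lebUnit
  | insert a t ha ih =>
    simp only [Finset.sum_insert ha]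
    filter_upwards [Lp.coeFn_add (c a • indicatorConstLp 1 (measurableSet_gridCell N a)
      (measure_ne_top lebUnit _) (1 : ℝ)) (∑ j ∈ t, c j • indicatorConstLp 1
      (measurableSet_gridCell N j) (measure_ne_top lebUnit _) (1 : ℝ)), ih,
      Lp.coeFn_smul (c a) (indicatorConstLp 1 (measurableSet_gridCell N a)
      (measure_ne_top lebUnit _) (1 : ℝ)), indicatorConstLp_coeFn (p := 1)
      (hs := measurableSet_gridCell N a) (hμs := measure_ne_top lebUnit _) (c := (1 : ℝ))]
      with x h1 h2 h3 h4
    rw [h1, Pi.add_apply, h2, h3, Pi.smul_apply, h4]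
    congr 1
    simp [indicator_apply]

/-- On each cell, of length at most `1 / N`, the error is at most the variation over the
corresponding closed interval, and these variations sum to the total one. -/
lemma edist_gridStep_le {N : ℕ} (hN : 1 ≤ N) {F : ℝ →₁[lebUnit] ℝ} {h : ℝ → ℝ}
    (hF : F =ᵐ[lebUnit] h) :
    edist F (gridStep N fun j => h ((j : ℝ) / N)) ≤ eVariationOn h (Icc 0 1) / N := by
  have hN' : (0 : ℝ) < N := by exact_mod_cast hN
  rw [edist_eq_lintegral_of_ae_eq hF (coeFn_gridStep N _)]
  set V : ℕ → ℝ≥0∞ := fun j => eVariationOn h (Icc ((j : ℝ) / N) (((j + 1 : ℕ) : ℝ) / N)) with hV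
  have hsum : ∑ j ∈ Finset.range N, V j = eVariationOn h (Icc 0 1) := by
    have hmono : Monotone fun j : ℕ => (j : ℝ) / N := fun i j hij => by
      dsimp only
      gcongr
    have := eVariationOn.sum' h hmono (n := N)
    simp only [Nat.cast_zero, zero_div, div_self hN'.ne'] at this
    exact this
  have hne : ∀ᵐ x ∂lebUnit, x ∈ Ico (0 : ℝ) 1 := by
    have h1 : ∀ᵐ x ∂lebUnit, x ≠ 1 := ae_restrict_of_ae (by simp [ae_iff])
    have h2 : ∀ᵐ x ∂lebUnit, x ∈ Icc (0 : ℝ) 1 := ae_restrict_mem measurableSet_Icc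
    filter_upwards [h1, h2] with x hx1 hx2
    exact ⟨hx2.1, lt_of_le_of_ne hx2.2 hx1⟩
  calc _ ≤ ∫⁻ x, ∑ j ∈ Finset.range N, (gridCell N j).indicator (fun _ => V j) x ∂lebUnit := by
        refine lintegral_mono_ae ?_
        filter_upwards [hne] with x hx
        have hiN : ⌊(N : ℝ) * x⌋₊ < N := by
          rw [Nat.floor_lt (mul_nonneg hN'.le hx.1)]
          nlinarith [hx.2]
        have hcell : x ∈ gridCell N ⌊(N : ℝ) * x⌋₊ := rfl
        have hother : ∀ j, j ≠ ⌊(N : ℝ) * x⌋₊ → x ∉ gridCell N j := fun j hj hx => hj hx.symm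
        rw [Finset.sum_eq_single_of_mem _ (Finset.mem_range.2 hiN)
            fun j _ hj => indicator_of_notMem (hother j hj) _,
          Finset.sum_eq_single_of_mem _ (Finset.mem_range.2 hiN)
            fun j _ hj => indicator_of_notMem (hother j hj) _,
          indicator_of_mem hcell, indicator_of_mem hcell, ← edist_eq_enorm_sub]
        have hxI := mem_Icc_of_mem_gridCell hN hx.1 hcell
        exact eVariationOn.edist_le h hxI ⟨le_rfl, hxI.1.trans hxI.2⟩
    _ = ∑ j ∈ Finset.range N, V j * lebUnit (gridCell N j) := by
        rw [lintegral_finsetSum _ fun j _ => measurable_const.indicator (measurableSet_gridCell N j)]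
        refine Finset.sum_congr rfl fun j _ => ?_
        rw [lintegral_indicator (measurableSet_gridCell N j), setLIntegral_const]
    _ ≤ ∑ j ∈ Finset.range N, V j * (N : ℝ≥0∞)⁻¹ :=
        Finset.sum_le_sum fun j _ => mul_le_mul' le_rfl (lebUnit_gridCell_le hN j)
    _ = _ := by rw [← Finset.sum_mul, hsum, div_eq_mul_inv]

lemma totallyBounded_bvSet (C : ℝ≥0) : TotallyBounded (bvSet C) := by
  rw [EMetric.totallyBounded_iff]
  intro ε hε
  have hε2 : ε / 2 ≠ 0 := (ENNReal.half_pos hε.ne').ne'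
  obtain ⟨N, hN⟩ := ENNReal.exists_nat_gt (r := (C : ℝ≥0∞) / (ε / 2))
    (ENNReal.div_ne_top ENNReal.coe_ne_top hε2)
  have hN1 : 1 ≤ N := by
    rcases Nat.eq_zero_or_pos N with rfl | h
    · simp at hN
    · exact h
  have hN0 : (N : ℝ≥0∞) ≠ 0 := by simpa using (by omega : N ≠ 0)
  have hCN : (C : ℝ≥0∞) / N < ε / 2 := by
    rw [ENNReal.div_lt_iff (Or.inl hN0) (Or.inl (ENNReal.natCast_ne_top N)), mul_comm]
    rwa [ENNReal.div_lt_iff (Or.inl hε2) (Or.inr ENNReal.coe_ne_top)] at hN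
  have hK : IsCompact (gridStep N '' Set.pi univ fun _ => Icc (-(C : ℝ)) C) :=
    (isCompact_univ_pi fun _ => isCompact_Icc).image (continuous_gridStep N)
  obtain ⟨t, ht, hcov⟩ := EMetric.totallyBounded_iff.1 hK.totallyBounded (ε / 2)
    (ENNReal.half_pos hε.ne')
  refine ⟨t, ht, ?_⟩
  rintro F ⟨h, hF, hV, hb⟩
  -- Only the first `N` values affect the step function; the default `0` keeps the whole sequence in
  -- the compact product.
  set c : ℕ → ℝ := fun j => if j < N then h ((j : ℝ) / N) else 0 with hc
  have hc' : gridStep N c = gridStep N fun j => h ((j : ℝ) / N) := by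
    unfold gridStep
    refine Finset.sum_congr rfl fun j hj => ?_
    rw [Finset.mem_range] at hj
    simp only [hc, if_pos hj]
  have hcmem : gridStep N c ∈ gridStep N '' Set.pi univ fun _ => Icc (-(C : ℝ)) C := by
    refine ⟨c, fun j _ => ?_, rfl⟩
    simp only [hc]
    split_ifs with hj
    · have hN' : (0 : ℝ) < N := by exact_mod_cast hN1
      have hj' : (j : ℝ) ≤ N := by exact_mod_cast hj.le
      have := hb ((j : ℝ) / N) ⟨by positivity, (div_le_one hN').2 hj'⟩
      rw [enorm_le_coe, ← NNReal.coe_le_coe, coe_nnnorm, Real.norm_eq_abs, abs_le] at this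
      exact this
    · simp
  obtain ⟨y, hy, hy'⟩ := mem_iUnion₂.1 (hcov hcmem)
  refine mem_iUnion₂.2 ⟨y, hy, ?_⟩
  rw [Metric.mem_eball] at hy' ⊢
  calc edist F y ≤ edist F (gridStep N c) + edist (gridStep N c) y := edist_triangle _ _ _
    _ < ε / 2 + ε / 2 := by
        refine ENNReal.add_lt_add (lt_of_le_of_lt ?_ hCN) hy'
        rw [hc']
        exact (edist_gridStep_le hN1 hF).trans (by gcongr)
    _ = ε := ENNReal.add_halves ε

lemma isCompact_closure_bvSet (C : ℝ≥0) : IsCompact (closure (bvSet C)) :=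
  isCompact_iff_totallyBounded_isComplete.2
    ⟨(totallyBounded_bvSet C).closure, isClosed_closure.isComplete⟩

end compactness

/-! ### Densities and invariance -/

section densities

variable {α β : ℝ}

/-- The test functions vary with `k` because the map itself does. Uniform boundedness handles `F k -
G`, and dominated convergence handles `G`. -/
lemma tendsto_integral_mul_of_tendsto {F : ℕ → ℝ →₁[lebUnit] ℝ} {G : ℝ →₁[lebUnit] ℝ}
    (hF : Tendsto F atTop (𝓝 G)) {ψ : ℕ → ℝ → ℝ} {ψ₀ : ℝ → ℝ} (hψ : ∀ k, Measurable (ψ k))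
    {M : ℝ} (hM : ∀ k x, |ψ k x| ≤ M) (hlim : ∀ x, Tendsto (fun k => ψ k x) atTop (𝓝 (ψ₀ x))) :
    Tendsto (fun k => ∫ x, F k x * ψ k x ∂lebUnit) atTop (𝓝 (∫ x, G x * ψ₀ x ∂lebUnit)) := by
  have hint : ∀ (H : ℝ →₁[lebUnit] ℝ) k, Integrable (fun x => H x * ψ k x) lebUnit := fun H k =>
    (L1.integrable_coeFn H).mul_bdd (hψ k).aestronglyMeasurable (.of_forall (hM k))
  have h1 : Tendsto (fun k => ∫ x, G x * ψ k x ∂lebUnit) atTop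
      (𝓝 (∫ x, G x * ψ₀ x ∂lebUnit)) := by
    refine tendsto_integral_of_dominated_convergence (fun x => |G x| * M)
      (fun k => (hint G k).aestronglyMeasurable) ((L1.integrable_coeFn G).abs.mul_const M)
      (fun k => .of_forall fun x => ?_) (.of_forall fun x => (hlim x).const_mul _)
    rw [Real.norm_eq_abs, abs_mul]
    exact mul_le_mul_of_nonneg_left (hM k x) (abs_nonneg _)
  have h2 : Tendsto (fun k => ∫ x, F k x * ψ k x ∂lebUnit - ∫ x, G x * ψ k x ∂lebUnit) atTop
      (𝓝 0) := by
    refine squeeze_zero_norm (a := fun k => ‖F k - G‖ * M) (fun k => ?_) ?_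
    · rw [← integral_sub (hint _ _) (hint _ _), L1.norm_eq_integral_norm, ← integral_mul_const]
      refine norm_integral_le_of_norm_le ((L1.integrable_coeFn (F k - G)).norm.mul_const M) ?_
      filter_upwards [Lp.coeFn_sub (F k) G] with x hx
      rw [← sub_mul, norm_mul, hx, Pi.sub_apply]
      exact mul_le_mul_of_nonneg_left (hM k x) (norm_nonneg _)
    · have := (tendsto_iff_norm_sub_tendsto_zero.1 hF).mul_const M
      simpa using this
  simpa using h2.add h1

lemma isDensity_of_tendsto {F : ℕ → ℝ →₁[lebUnit] ℝ} {G : ℝ →₁[lebUnit] ℝ}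
    (hF : Tendsto F atTop (𝓝 G)) (hd : ∀ k, IsDensity (F k)) : IsDensity G := by
  refine ⟨L1.integrable_coeFn G, ?_, ?_⟩
  · refine (Lp.coeFn_nonneg G).2 (ge_of_tendsto' hF fun k => ?_)
    exact (Lp.coeFn_nonneg (F k)).1 (hd k).nonneg
  · have := tendsto_integral_mul_of_tendsto hF (ψ := fun _ _ => 1) (ψ₀ := fun _ => 1) (M := 1)
      (fun _ => measurable_const) (fun _ _ => by simp) fun _ => tendsto_const_nhds
    simp only [mul_one, (hd _).integral_eq_one] at this
    exact (tendsto_nhds_unique this tendsto_const_nhds)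

lemma IsDensity.integral_withDensity {f : ℝ → ℝ} (hf : IsDensity f) (φ : ℝ → ℝ) :
    ∫ x, φ x ∂(lebUnit.withDensity fun x => ENNReal.ofReal (f x)) =
      ∫ x, f x * φ x ∂lebUnit := by
  rw [integral_withDensity_eq_integral_toReal_smul₀ hf.integrable.aemeasurable.ennreal_ofReal
    (.of_forall fun _ => ENNReal.ofReal_lt_top)]
  refine integral_congr_ae ?_
  filter_upwards [hf.nonneg] with x hx
  rw [ENNReal.toReal_ofReal hx, smul_eq_mul]

lemma IsInvariantDensity.of_integral_eq (h : (α, β) ∈ paramRegion) {f : ℝ → ℝ}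
    (hf : IsDensity f) (hinv : ∀ φ : BoundedContinuousFunction ℝ ℝ,
      ∫ x, f x * φ (tent α β x) ∂lebUnit = ∫ x, f x * φ x ∂lebUnit) :
    IsInvariantDensity α β f := by
  have hT := (continuous_tent h).measurable
  refine ⟨hf, hT, ?_⟩
  have : IsFiniteMeasure (lebUnit.withDensity fun x => ENNReal.ofReal (f x)) :=
    isFiniteMeasure_withDensity_ofReal hf.integrable.2
  refine ext_of_forall_integral_eq_of_IsFiniteMeasure fun φ => ?_
  rw [integral_map hT.aemeasurable φ.continuous.aestronglyMeasurable,
    hf.integral_withDensity fun x => φ (tent α β x), hf.integral_withDensity, hinv]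

lemma IsInvariantDensity.integral_eq {f : ℝ → ℝ} (hf : IsInvariantDensity α β f) {φ : ℝ → ℝ}
    (hφ : Measurable φ) :
    ∫ x, f x * φ (tent α β x) ∂lebUnit = ∫ x, f x * φ x ∂lebUnit := by
  rw [← hf.isDensity.integral_withDensity fun x => φ (tent α β x),
    ← hf.isDensity.integral_withDensity,
    ← integral_map hf.invariant.measurable.aemeasurable hφ.aestronglyMeasurable,
    hf.invariant.map_eq]

lemma IsInvariantDensity.frobeniusPerron_ae_eq (h : (α, β) ∈ paramRegion) {f : ℝ → ℝ}
    (hf : IsInvariantDensity α β f) : frobeniusPerron α β f =ᵐ[lebUnit] f := by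
  have hfi := hf.isDensity.integrable
  refine Integrable.ae_eq_of_forall_setIntegral_eq _ _
    (frobeniusPerron_integrable_and_integral h hfi).1 hfi fun A hA _ => ?_
  have hφ : Measurable (A.indicator fun _ => (1 : ℝ)) := measurable_const.indicator hA
  have hset : ∀ g : ℝ → ℝ, ∫ x in A, g x ∂lebUnit =
      ∫ x, g x * A.indicator (fun _ => (1 : ℝ)) x ∂lebUnit := by
    intro g
    rw [← integral_indicator hA]
    congr 1
    ext x
    by_cases hx : x ∈ A <;> simp [hx]
  rw [hset, hset, integral_frobeniusPerron_mul h, hf.integral_eq hφ]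
  refine hfi.mul_bdd (c := 1)
    (hφ.comp (continuous_tent h).measurable).aestronglyMeasurable (.of_forall fun x => ?_)
  by_cases hx : tent α β x ∈ A <;> simp [hx]

/-- In this form continuity in the parameters needs no case distinction at the moving turning point.
-/
lemma tent_eq_min (h : (α, β) ∈ paramRegion) (x : ℝ) :
    tent α β x = min (β / α * x) (β / (1 - α) * (1 - x)) := by
  obtain ⟨h0, h1, h2, -⟩ := paramRegion_bounds h
  have h1' : 0 < 1 - α := by linarith
  have e : β / (1 - α) * (1 - x) - β / α * x = β * (α - x) / (α * (1 - α)) := by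
    field_simp
    ring
  rcases le_total x α with hx | hx
  · rw [tent_of_le hx, min_eq_left]
    rw [← sub_nonneg, e]
    have : 0 ≤ α - x := by linarith
    positivity
  · rw [tent_of_ge h hx, min_eq_right]
    rw [← sub_nonpos, e]
    exact div_nonpos_of_nonpos_of_nonneg
      (mul_nonpos_of_nonneg_of_nonpos h2.le (by linarith)) (by positivity)

lemma tendsto_tent {ι : Type*} {l : Filter ι} {a b : ι → ℝ} (hab : ∀ i, (a i, b i) ∈ paramRegion)
    (h : (α, β) ∈ paramRegion) (ha : Tendsto a l (𝓝 α)) (hb : Tendsto b l (𝓝 β)) (x : ℝ) :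
    Tendsto (fun i => tent (a i) (b i) x) l (𝓝 (tent α β x)) := by
  obtain ⟨h0, h1, -⟩ := paramRegion_bounds h
  have h1' : 1 - α ≠ 0 := by linarith
  simp only [tent_eq_min (hab _), tent_eq_min h]
  exact ((hb.div ha h0.ne').mul_const x).min
    ((hb.div (ha.const_sub 1) h1').mul_const (1 - x))

/-- Limits of invariant densities along convergent parameters are invariant densities. -/
lemma isInvariantDensity_of_tendsto {a b : ℕ → ℝ} (hab : ∀ i, (a i, b i) ∈ paramRegion)
    (h : (α, β) ∈ paramRegion) (ha : Tendsto a atTop (𝓝 α)) (hb : Tendsto b atTop (𝓝 β))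
    {F : ℕ → ℝ →₁[lebUnit] ℝ} {G : ℝ →₁[lebUnit] ℝ} (hF : Tendsto F atTop (𝓝 G))
    (hinv : ∀ k, IsInvariantDensity (a k) (b k) (F k)) : IsInvariantDensity α β G := by
  refine IsInvariantDensity.of_integral_eq h (isDensity_of_tendsto hF fun k => (hinv k).isDensity)
    fun φ => ?_
  have hb' : ∀ x, |φ x| ≤ ‖φ‖ := fun x => φ.norm_coe_le_norm x
  have h1 := tendsto_integral_mul_of_tendsto hF
    (ψ := fun k x => φ (tent (a k) (b k) x)) (ψ₀ := fun x => φ (tent α β x)) (M := ‖φ‖)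
    (fun k => φ.continuous.measurable.comp (continuous_tent (hab k)).measurable)
    (fun k x => hb' _) fun x => (φ.continuous.tendsto _).comp (tendsto_tent hab h ha hb x)
  have h2 := tendsto_integral_mul_of_tendsto hF (ψ := fun _ x => φ x) (ψ₀ := φ) (M := ‖φ‖)
    (fun _ => φ.continuous.measurable) (fun _ x => hb' x) fun _ => tendsto_const_nhds
  simp only [fun k => (hinv k).integral_eq φ.continuous.measurable] at h1
  exact tendsto_nhds_unique h1 h2

end densities

/-! ### Invariant densities: existence and a priori bounds -/

section invariant

variable {α β : ℝ} {m : ℕ} {D : ℝ≥0}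

lemma IsDensity.lintegral_enorm {f : ℝ → ℝ} (hf : IsDensity f) :
    ∫⁻ x, ‖f x‖ₑ ∂lebUnit = 1 := by
  rw [← ofReal_integral_norm_eq_lintegral_enorm hf.integrable, ← ENNReal.ofReal_one,
    ← hf.integral_eq_one]
  congr 1
  refine integral_congr_ae ?_
  filter_upwards [hf.nonneg] with x hx
  exact abs_of_nonneg hx

lemma exists_boundedVariation_lintegral_sub_le {f : ℝ → ℝ} (hf : Integrable f lebUnit) {ε : ℝ}
    (hε : 0 < ε) : ∃ g : ℝ → ℝ, Integrable g lebUnit ∧ eVariationOn g (Icc 0 1) ≠ ∞ ∧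
      ∫⁻ x, ‖f x - g x‖ₑ ∂lebUnit ≤ ENNReal.ofReal ε := by
  obtain ⟨g, hg1, hg2, hg3⟩ := (memLp_one_iff_integrable.2 hf).exist_eLpNorm_sub_le
    ENNReal.one_ne_top le_rfl hε
  rw [eLpNorm_one_eq_lintegral_enorm] at hg3
  refine ⟨g, hg2.continuous.integrable_of_hasCompactSupport hg1, ?_, hg3⟩
  obtain ⟨C, hC⟩ := hg2.lipschitzWith_of_hasCompactSupport hg1 (by simp)
  have := hC.locallyBoundedVariationOn (Icc 0 1) 0 1 (by simp) (by simp)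
  rwa [inter_self] at this

/-- An invariant density is a limit in `L¹` of functions with a uniformly bounded variation. -/
lemma LasotaYorke.mem_closure_bvSet (hLY : LasotaYorke α β m D) (h : (α, β) ∈ paramRegion)
    {f : ℝ →₁[lebUnit] ℝ} (hf : IsInvariantDensity α β f) :
    f ∈ closure (bvSet (4 * D + 3)) := by
  refine Metric.mem_closure_iff.2 fun ε hε => ?_
  have hfi := hf.isDensity.integrable
  -- The minimum with `1` keeps the norm of `g` at most `2`, so the final bounds do not depend on
  -- `ε`; the variation of `g` does, but `j` is chosen to damp it.
  obtain ⟨g, hgi, hgV, hg⟩ := exists_boundedVariation_lintegral_sub_le hfi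
    (show 0 < min (ε / 2) 1 by positivity)
  have hg2 : ∫⁻ x, ‖g x‖ₑ ∂lebUnit ≤ 2 := by
    calc _ ≤ ∫⁻ x, (‖f x‖ₑ + ‖f x - g x‖ₑ) ∂lebUnit := by
          refine lintegral_mono fun x => ?_
          calc ‖g x‖ₑ = ‖f x - (f x - g x)‖ₑ := by rw [sub_sub_cancel]
            _ ≤ _ := enorm_sub_le
      _ = 1 + ∫⁻ x, ‖f x - g x‖ₑ ∂lebUnit := by
          rw [lintegral_add_left' hfi.aestronglyMeasurable.enorm, hf.isDensity.lintegral_enorm]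
      _ ≤ 1 + 1 := by
          gcongr
          refine hg.trans ?_
          rw [← ENNReal.ofReal_one]
          exact ENNReal.ofReal_le_ofReal (min_le_right _ _)
      _ = 2 := one_add_one_eq_two
  obtain ⟨j, hj⟩ : ∃ j : ℕ, (2⁻¹ : ℝ≥0∞) ^ j * eVariationOn g (Icc 0 1) < 1 := by
    have h1 := ENNReal.Tendsto.mul_const
      (ENNReal.tendsto_pow_atTop_nhds_zero_of_lt_one (r := 2⁻¹) (by simp)) (Or.inr hgV)
    rw [zero_mul] at h1
    exact (h1.eventually_lt_const one_pos).exists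
  set q := (prunedFP α β)^[m * j] g with hq
  have hqi : Integrable q lebUnit := integrable_prunedFP_iterate h hgi _
  have hqN : ∫⁻ x, ‖q x‖ₑ ∂lebUnit ≤ 2 :=
    (lintegral_enorm_prunedFP_iterate_le h hgi _).trans hg2
  have hqV : eVariationOn q (Icc 0 1) ≤ 4 * D + 1 := by
    calc _ ≤ 2⁻¹ ^ j * eVariationOn g (Icc 0 1) + 2 * D * ∫⁻ x, ‖g x‖ₑ ∂lebUnit :=
          hLY.eVariationOn_iterate_mul_le h hgi j
      _ ≤ 1 + 2 * D * 2 := add_le_add hj.le (mul_le_mul' le_rfl hg2)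
      _ = _ := by ring
  refine ⟨hqi.toL1 q, ⟨q, hqi.coeFn_toL1, ?_, fun x hx => ?_⟩, ?_⟩
  · push_cast
    refine hqV.trans ?_
    gcongr
    norm_num
  · push_cast
    calc _ ≤ _ := enorm_le_eVariationOn_add_lintegral q hx
      _ ≤ 4 * D + 1 + 2 := add_le_add hqV hqN
      _ = _ := by ring
  · have hle : edist f (hqi.toL1 q) ≤ ENNReal.ofReal (ε / 2) := by
      rw [edist_eq_lintegral_of_ae_eq EventuallyEq.rfl hqi.coeFn_toL1]
      exact (lintegral_enorm_sub_prunedFP_iterate_le h hfi (hf.frobeniusPerron_ae_eq h) hgi _).trans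
        (hg.trans (ENNReal.ofReal_le_ofReal (min_le_left _ _)))
    have := (edist_le_ofReal (half_pos hε).le).1 hle
    linarith

/-- The averages of the first iterates of the constant density. -/
def cesaroFP (α β : ℝ) (N : ℕ) (x : ℝ) : ℝ :=
  ((N + 1 : ℕ) : ℝ)⁻¹ * ∑ k ∈ Finset.range (N + 1), (prunedFP α β)^[k] (fun _ => 1) x

lemma prunedFP_iterate_nonneg (h : (α, β) ∈ paramRegion) (k : ℕ) :
    ∀ x, 0 ≤ (prunedFP α β)^[k] (fun _ => 1) x := by
  obtain ⟨h0, h1, h2, -⟩ := paramRegion_bounds h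
  have h1' : 0 < 1 - α := by linarith
  induction k with
  | zero => intro x; simp
  | succ k ih =>
    intro x
    rw [Function.iterate_succ_apply', prunedFP]
    have hL := ih (α * x / β)
    have hR := ih (1 - (1 - α) * x / β)
    split_ifs
    · positivity
    · exact le_rfl

lemma integral_prunedFP_iterate (h : (α, β) ∈ paramRegion) {f : ℝ → ℝ}
    (hf : Integrable f lebUnit) (k : ℕ) :
    ∫ x, (prunedFP α β)^[k] f x ∂lebUnit = ∫ x, f x ∂lebUnit := by
  induction k with
  | zero => rfl
  | succ k ih =>
    rw [Function.iterate_succ_apply', integral_congr_ae (prunedFP_ae_eq h _),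
      (frobeniusPerron_integrable_and_integral h (integrable_prunedFP_iterate h hf k)).2, ih]

lemma isDensity_prunedFP_iterate_one (h : (α, β) ∈ paramRegion) (k : ℕ) :
    IsDensity ((prunedFP α β)^[k] fun _ => 1) :=
  ⟨integrable_prunedFP_iterate h (integrable_const _) k,
    .of_forall (prunedFP_iterate_nonneg h k),
    by rw [integral_prunedFP_iterate h (integrable_const _)]; simp⟩

lemma isDensity_cesaroFP (h : (α, β) ∈ paramRegion) (N : ℕ) : IsDensity (cesaroFP α β N) := by
  refine ⟨?_, .of_forall fun x => ?_, ?_⟩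
  · exact (integrable_finsetSum _ fun k _ =>
      (isDensity_prunedFP_iterate_one h k).integrable).const_mul _
  · exact mul_nonneg (by positivity) (Finset.sum_nonneg fun k _ => prunedFP_iterate_nonneg h k x)
  · simp only [cesaroFP]
    rw [integral_const_mul, integral_finsetSum _ fun k _ =>
      (isDensity_prunedFP_iterate_one h k).integrable]
    simp only [(isDensity_prunedFP_iterate_one h _).integral_eq_one, Finset.sum_const,
      Finset.card_range, nsmul_eq_mul, mul_one]
    exact inv_mul_cancel₀ (by positivity)

lemma LasotaYorke.eVariationOn_cesaroFP_le (hLY : LasotaYorke α β m D) (hm : 1 ≤ m)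
    (h : (α, β) ∈ paramRegion) (N : ℕ) :
    eVariationOn (cesaroFP α β N) (Icc 0 1) ≤ 4 ^ m * D + 2 * D := by
  have h1 : ∀ k, eVariationOn ((prunedFP α β)^[k] fun _ => 1) (Icc 0 1) ≤
      4 ^ m * D + 2 * D := by
    intro k
    have h2 : eVariationOn (fun _ : ℝ => (1 : ℝ)) (Icc 0 1) = 0 :=
      eVariationOn.constant_on (by rintro _ ⟨x, _, rfl⟩ _ ⟨y, _, rfl⟩; rfl)
    have := hLY.eVariationOn_iterate_le hm h (integrable_const (1 : ℝ)) k
    simpa [h2] using this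
  have hN : (0 : ℝ) < (N + 1 : ℕ) := by positivity
  calc _ ≤ ENNReal.ofReal |((N + 1 : ℕ) : ℝ)⁻¹| * eVariationOn
        (fun x => ∑ k ∈ Finset.range (N + 1), (prunedFP α β)^[k] (fun _ => 1) x) (Icc 0 1) :=
        eVariationOn_const_mul _ _ _
    _ ≤ ((N + 1 : ℕ) : ℝ≥0∞)⁻¹ * ∑ k ∈ Finset.range (N + 1), (4 ^ m * (D : ℝ≥0∞) + 2 * D) := by
        refine mul_le_mul' (le_of_eq ?_) ((eVariationOn_finset_sum_le _ _ _).trans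
          (Finset.sum_le_sum fun k _ => h1 k))
        rw [abs_of_pos (inv_pos.2 hN), ENNReal.ofReal_inv_of_pos hN, ENNReal.ofReal_natCast]
    _ = _ := by
        rw [Finset.sum_const, Finset.card_range, nsmul_eq_mul, ← mul_assoc,
          ENNReal.inv_mul_cancel (by simp) (ENNReal.natCast_ne_top _), one_mul]

/-- By duality, composing `φ` with the map shifts the iterate by one, so the difference of the
averages telescopes to two boundary terms. -/
lemma abs_integral_cesaroFP_sub_le (h : (α, β) ∈ paramRegion) {φ : ℝ → ℝ} (hφ : Measurable φ)
    {M : ℝ} (hM : ∀ x, |φ x| ≤ M) (N : ℕ) :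
    |∫ x, cesaroFP α β N x * φ (tent α β x) ∂lebUnit - ∫ x, cesaroFP α β N x * φ x ∂lebUnit| ≤
      2 * M * (1 / ((N : ℝ) + 1)) := by
  set q : ℕ → ℝ → ℝ := fun k => (prunedFP α β)^[k] fun _ => 1 with hq
  have hqi : ∀ k, Integrable (q k) lebUnit := fun k =>
    (isDensity_prunedFP_iterate_one h k).integrable
  have hi : ∀ ψ : ℝ → ℝ, Measurable ψ → (∀ x, |ψ x| ≤ M) → ∀ k,
      Integrable (fun x => q k x * ψ x) lebUnit := fun ψ hψ hψM k =>
    (hqi k).mul_bdd hψ.aestronglyMeasurable (.of_forall hψM)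
  have hφT : Measurable fun x => φ (tent α β x) := hφ.comp (continuous_tent h).measurable
  have hsum : ∀ ψ : ℝ → ℝ, Measurable ψ → (∀ x, |ψ x| ≤ M) →
      ∫ x, cesaroFP α β N x * ψ x ∂lebUnit =
        ((N + 1 : ℕ) : ℝ)⁻¹ * ∑ k ∈ Finset.range (N + 1), ∫ x, q k x * ψ x ∂lebUnit := by
    intro ψ hψ hψM
    rw [← integral_finsetSum _ fun k _ => hi ψ hψ hψM k, ← integral_const_mul]
    simp only [cesaroFP, mul_assoc, Finset.sum_mul, hq]
  have hshift : ∀ k, ∫ x, q k x * φ (tent α β x) ∂lebUnit = ∫ x, q (k + 1) x * φ x ∂lebUnit := by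
    intro k
    rw [← integral_frobeniusPerron_mul h (hi _ hφT (fun x => hM _) k)]
    refine integral_congr_ae ?_
    filter_upwards [prunedFP_ae_eq h (q k)] with x hx
    simp only [hq, Function.iterate_succ_apply'] at hx ⊢
    rw [hx]
  have hbound : ∀ k, |∫ x, q k x * φ x ∂lebUnit| ≤ M := by
    intro k
    have h1 : ‖∫ x, q k x * φ x ∂lebUnit‖ ≤ ∫ x, q k x * M ∂lebUnit := by
      refine norm_integral_le_of_norm_le ((hqi k).mul_const M) (.of_forall fun x => ?_)
      rw [norm_mul, Real.norm_of_nonneg (prunedFP_iterate_nonneg h k x)]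
      exact mul_le_mul_of_nonneg_left (hM x) (prunedFP_iterate_nonneg h k x)
    rwa [integral_mul_const, (isDensity_prunedFP_iterate_one h k).integral_eq_one, one_mul] at h1
  rw [hsum _ hφT fun x => hM _, hsum φ hφ hM, ← mul_sub, ← Finset.sum_sub_distrib]
  simp only [hshift]
  rw [Finset.sum_range_sub (fun k => ∫ x, q k x * φ x ∂lebUnit), abs_mul,
    abs_of_pos (by positivity), mul_comm, one_div]
  push_cast
  refine mul_le_mul_of_nonneg_right ?_ (by positivity)
  refine (abs_sub _ _).trans ?_
  linarith [hbound (N + 1), hbound 0]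

/-- Existence of an invariant density, as a limit of averages of iterates. -/
lemma LasotaYorke.exists_isInvariantDensity (hLY : LasotaYorke α β m D) (hm : 1 ≤ m)
    (h : (α, β) ∈ paramRegion) :
    ∃ f : ℝ →₁[lebUnit] ℝ, IsInvariantDensity α β f := by
  set A : ℕ → ℝ →₁[lebUnit] ℝ := fun N => (isDensity_cesaroFP h N).integrable.toL1 _ with hA
  have hAe : ∀ N, A N =ᵐ[lebUnit] cesaroFP α β N := fun N =>
    (isDensity_cesaroFP h N).integrable.coeFn_toL1
  have hAint : ∀ N (ψ : ℝ → ℝ), ∫ x, A N x * ψ x ∂lebUnit =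
      ∫ x, cesaroFP α β N x * ψ x ∂lebUnit := fun N ψ => by
    refine integral_congr_ae ?_
    filter_upwards [hAe N] with x hx
    rw [hx]
  have hAd : ∀ N, IsDensity (A N) := fun N =>
    ⟨L1.integrable_coeFn _, by
      filter_upwards [hAe N, (isDensity_cesaroFP h N).nonneg] with x hx hx'
      rwa [hx],
    by rw [integral_congr_ae (hAe N), (isDensity_cesaroFP h N).integral_eq_one]⟩
  have hmem : ∀ N, A N ∈ closure (bvSet (4 ^ m * D + 2 * D + 1)) := by
    intro N
    have hV := hLY.eVariationOn_cesaroFP_le hm h N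
    refine subset_closure ⟨cesaroFP α β N, hAe N, ?_, fun x hx => ?_⟩
    · push_cast
      exact hV.trans le_self_add
    · push_cast
      refine (enorm_le_eVariationOn_add_lintegral _ hx).trans (add_le_add hV ?_)
      rw [(isDensity_cesaroFP h N).lintegral_enorm]
  obtain ⟨G, -, θ, hθ, hG⟩ := (isCompact_closure_bvSet _).tendsto_subseq hmem
  refine ⟨G, IsInvariantDensity.of_integral_eq h (isDensity_of_tendsto hG fun k => hAd _)
    fun φ => ?_⟩
  have hb : ∀ x, |φ x| ≤ ‖φ‖ := fun x => φ.norm_coe_le_norm x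
  have hφ : Measurable φ := φ.continuous.measurable
  have h1 := tendsto_integral_mul_of_tendsto hG (ψ := fun _ x => φ (tent α β x))
    (ψ₀ := fun x => φ (tent α β x)) (M := ‖φ‖)
    (fun _ => hφ.comp (continuous_tent h).measurable) (fun _ x => hb _)
    fun _ => tendsto_const_nhds
  have h2 := tendsto_integral_mul_of_tendsto hG (ψ := fun _ x => φ x) (ψ₀ := φ) (M := ‖φ‖)
    (fun _ => hφ) (fun _ x => hb x) fun _ => tendsto_const_nhds
  have h3 : Tendsto (fun k => ∫ x, (A ∘ θ) k x * φ (tent α β x) ∂lebUnit -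
      ∫ x, (A ∘ θ) k x * φ x ∂lebUnit) atTop (𝓝 0) := by
    refine squeeze_zero_norm (a := fun k => 2 * ‖φ‖ * (1 / ((θ k : ℝ) + 1))) (fun k => ?_) ?_
    · simp only [Function.comp_apply]
      rw [hAint _ fun x => φ (tent α β x), hAint _ φ]
      exact abs_integral_cesaroFP_sub_le h hφ hb _
    · have := ((tendsto_one_div_add_atTop_nhds_zero_nat (𝕜 := ℝ)).comp
        hθ.tendsto_atTop).const_mul (2 * ‖φ‖)
      simpa only [mul_zero, Function.comp_def] using this
  exact sub_eq_zero.1 (tendsto_nhds_unique (h1.sub h2) h3)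

end invariant

/-- A convergent sequence of numbers less than one, whose limit is one of its members, is bounded
away from one. -/
lemma exists_lt_one_forall_le {r : ℕ → ℝ} (hr : ∀ n, r n < 1) {i : ℕ}
    (hlim : Tendsto r atTop (𝓝 (r i))) : ∃ κ < 1, ∀ n, r n ≤ κ := by
  have hK := hlim.isCompact_insert_range
  rw [insert_eq_of_mem (mem_range_self i)] at hK
  obtain ⟨_, ⟨j, rfl⟩, hj⟩ := hK.exists_isMaxOn (range_nonempty r) continuousOn_id
  exact ⟨r j, hr j, fun n => hj (mem_range_self n)⟩

end SkewTent

end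

/-! ### Assembly of the uniform estimates -/

theorem mainTheorem4 (α β : ℕ → ℝ)
    (hU : ∀ n, (α n, β n) ∈ SkewTent.paramRegion)
    (hlim : Tendsto (fun n => (α n, β n)) atTop (𝓝 (α 0, β 0)))
    (hpart : ∀ m : ℕ, 1 ≤ m → ∃ δ : ℝ, 0 < δ ∧
      ∀ n, ∀ I ∈ SkewTent.cylinderPartition (α n) (β n) m, δ ≤ volume.real I) :
    -- uniform bound on the variations of the iterated Frobenius-Perron images
    (∀ f : ℝ → ℝ, SkewTent.IsDensity f → BoundedVariationOn f (Icc 0 1) →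
      ∃ M : ℝ≥0, ∀ n k : ℕ, 1 ≤ k →
        eVariationOn ((SkewTent.frobeniusPerron (α n) (β n))^[k] f) (Icc 0 1) ≤ M) ∧
    -- existence of invariant densities
    (∀ n, ∃ f : ℝ →₁[SkewTent.lebUnit] ℝ, SkewTent.IsInvariantDensity (α n) (β n) f) ∧
    -- for every choice of invariant densities: precompactness, and invariance of the limits
    (∀ f : ℕ → (ℝ →₁[SkewTent.lebUnit] ℝ),
      (∀ n, SkewTent.IsInvariantDensity (α n) (β n) (f n)) →
        IsCompact (closure (range f)) ∧
        ∀ (φ : ℕ → ℕ) (g : ℝ →₁[SkewTent.lebUnit] ℝ), StrictMono φ →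
          Tendsto (fun k => f (φ k)) atTop (𝓝 g) →
            SkewTent.IsInvariantDensity (α 0) (β 0) g) := by
  open SkewTent in
  have hb := fun n => paramRegion_bounds (hU n)
  have hα : Tendsto α atTop (𝓝 (α 0)) := (continuous_fst.tendsto _).comp hlim
  have hβ : Tendsto β atTop (𝓝 (β 0)) := (continuous_snd.tendsto _).comp hlim
  have hβ0 : β 0 ≠ 0 := (hb 0).2.2.1.ne'
  obtain ⟨κ₁, hκ₁, hκ₁'⟩ := exists_lt_one_forall_le (r := fun n => α n / β n) (i := 0)
    (fun n => (div_lt_one (hb n).2.2.1).2 (hb n).2.2.2.2.1) (hα.div hβ hβ0)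
  obtain ⟨κ₂, hκ₂, hκ₂'⟩ := exists_lt_one_forall_le (r := fun n => (1 - α n) / β n) (i := 0)
    (fun n => (div_lt_one (hb n).2.2.1).2 (hb n).2.2.2.2.2.1) ((hα.const_sub 1).div hβ hβ0)
  have hκ : max κ₁ κ₂ < 1 := max_lt hκ₁ hκ₂
  have hκ1 : ∀ n, α n / β n ≤ max κ₁ κ₂ := fun n => (hκ₁' n).trans (le_max_left _ _)
  have hκ2 : ∀ n, (1 - α n) / β n ≤ max κ₁ κ₂ := fun n => (hκ₂' n).trans (le_max_right _ _)
  have hκ0 : 0 ≤ max κ₁ κ₂ := (div_nonneg (hb 0).1.le (hb 0).2.2.1.le).trans (hκ1 0)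
  obtain ⟨m, D, hm, hLY⟩ := exists_lasotaYorke hU hpart hκ0 hκ hκ1 hκ2
  refine ⟨fun f hf hV => ?_, fun n => (hLY n).exists_isInvariantDensity hm (hU n),
    fun f hf => ⟨?_, fun φ g hφ hg => ?_⟩⟩
  · set C : ℝ≥0∞ := 4 ^ m * (eVariationOn f (Icc 0 1) + D) + 2 * D with hC
    have hCtop : C ≠ ∞ := by
      have : eVariationOn f (Icc 0 1) ≠ ∞ := hV
      finiteness
    have hQV : ∀ n k, eVariationOn ((prunedFP (α n) (β n))^[k] f) (Icc 0 1) ≤ C := by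
      intro n k
      have := (hLY n).eVariationOn_iterate_le hm (hU n) hf.integrable k
      rwa [hf.lintegral_enorm, mul_one, mul_one] at this
    -- These values determine the heights of the new spikes; variation plus `L¹` norm bounds them at
    -- every point of `[0,1]`.
    have hQb : ∀ n k, |(prunedFP (α n) (β n))^[k] f (α n)| ≤ (C + 1).toReal := by
      intro n k
      have h1 : ‖(prunedFP (α n) (β n))^[k] f (α n)‖ₑ ≤ C + 1 := by
        refine (enorm_le_eVariationOn_add_lintegral _ ⟨(hb n).1.le, (hb n).2.1.le⟩).trans
          (add_le_add (hQV n k) ?_)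
        rw [← hf.lintegral_enorm]
        exact lintegral_enorm_prunedFP_iterate_le (hU n) hf.integrable k
      rw [← Real.norm_eq_abs, ← toReal_enorm]
      exact ENNReal.toReal_mono (by finiteness) h1
    have hMtop : C + ENNReal.ofReal (4 * (C + 1).toReal / (1 - max κ₁ κ₂) ^ 2) ≠ ∞ := by
      finiteness
    refine ⟨(C + ENNReal.ofReal (4 * (C + 1).toReal / (1 - max κ₁ κ₂) ^ 2)).toNNReal,
      fun n k _ => ?_⟩
    rw [ENNReal.coe_toNNReal hMtop]
    exact (eVariationOn_frobeniusPerron_iterate_le (hU n) (hκ1 n) (hκ2 n) hκ (hQb n) k _).trans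
      (add_le_add (hQV n k) le_rfl)
  · refine (isCompact_closure_bvSet (4 * D + 3)).of_isClosed_subset isClosed_closure
      (closure_minimal ?_ isClosed_closure)
    rintro _ ⟨n, rfl⟩
    exact (hLY n).mem_closure_bvSet (hU n) (hf n)
  · exact isInvariantDensity_of_tendsto (fun k => hU (φ k)) (hU 0)
      (hα.comp hφ.tendsto_atTop) (hβ.comp hφ.tendsto_atTop) hg fun k => hf (φ k)
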